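/- For an integer $k\ge 1$ put $q=e^{2\pi i\tau}$, $\zeta=e^{2\pi i w}$, $\eta(\tau)=q^{1/24}\prod_{n\ge1}(1-q^n)$, $$\theta_1(w;\tau)=i\zeta^{1/2}q^{1/8}\prod_{n\ge 1}(1-q^n)(1-\zeta q^n)(1-\zeta^{-1}q^{n-1}),\qquad h_k(w;\tau)=\frac{i}{\theta_1(w;\tau)\,\eta(\tau)^{k-3}}.$$ Let $a_{m,k}(n)$ ($m\in\mathbb{Z}$, $n\ge 0$) be the coefficients defined by the absolutely convergent expansion $$q^{k/24}\left(\zeta^{1/2}-\zeta^{-1/2}\right)h_k(w;\tau)=\sum_{n\ge 0,\ m\in\mathbb{Z}}a_{m,k}(n)\,\zeta^m q^n,\qquad |\zeta q|<1,\ |\zeta^{-1}q|<1$$ (with $\zeta\neq1$, where the left-hand side has a removable singularity). Let $$\vartheta_m(q)=\left(1+q^{|m|}\right)\sum_{n\ge 0}(-1)^n q^{\frac{n(n+1)}{2}+n|m|}-1 ,\qquad |q|<1,$$ and let $d_{m,k}(\ell)$ ($\ell\ge1$) be the coefficients of its asymptotic Taylor expansion in $z$, where $q=e^{-z}$ and $q^{k/24}=e^{-kz/24}$: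 for every $N\ge1$, $$q^{k/24}\vartheta_m(q)=\sum_{\ell=1}^N d_{m,k}(\ell)z^\ell+O\left(z^{N+1}\right)$$ as $z\to0$ in any sector $|\operatorname{Im} z|\le C\operatorname{Re} z$, $\operatorname{Re} z>0$. Let $I_\nu(x)=\sum_{j\ge0}\frac{(x/2)^{2j+\nu}}{j!\,\Gamma(\nu+j+1)}$ be the modified Bessel function of the first kind. **Theorem.** Let $k\ge1$. The coefficients $a_{m,k}(n)$ and $d_{m,k}(\ell)$ exist and are uniquely determined by these expansions, and for every $m\in\mathbb{Z}$ and every $N\ge 1$, as $n\to\infty$, $$a_{m,k}(n)=(2\pi)^{-k/2}\sum_{\ell=1}^N d_{m,k}(\ell)\, n^{-\frac{2+2\ell+k}{4}}\left(\pi\sqrt{\tfrac{k}{6}}\right)^{1+\ell+\frac k2} I_{-1-\ell-\frac k2}\!\left(\pi\sqrt{\tfrac{2kn}{3}}\right)+O\!\left(n^{-1-\frac N2-\frac k4}e^{\pi\sqrt{2kn/3}}\right),$$ where the implied constant depends only on $k$, $m$ and $N$. -/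

import Mathlib

open Filter Asymptotics
open scoped Topology

namespace InverseTheta

noncomputable section

/-- `e(x) = exp(2 π i x)`; thus `q = e τ`, `ζ = e w`, `q ^ (1/8) = e (τ / 8)`,
`ζ ^ (1/2) = e (w / 2)`. -/
def e (x : ℂ) : ℂ := Complex.exp (2 * Real.pi * Complex.I * x)

/-- The Jacobi theta function
`θ₁(w; τ) = i ζ^(1/2) q^(1/8) ∏_{n ≥ 1} (1 - q^n) (1 - ζ q^n) (1 - ζ⁻¹ q^(n-1))`. -/
def theta1 (w τ : ℂ) : ℂ :=
  Complex.I * e (w / 2) * e (τ / 8) *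
    ∏' n : ℕ, (1 - e τ ^ (n + 1)) * (1 - e w * e τ ^ (n + 1)) * (1 - (e w)⁻¹ * e τ ^ n)

/-- `h_k(w; τ) = i / (θ₁(w; τ) η(τ)^(k-3))`, with `η` the Dedekind eta function. -/
def h (k : ℕ) (w τ : ℂ) : ℂ :=
  Complex.I / (theta1 w τ * ModularForm.eta τ ^ ((k : ℤ) - 3))

/-- `a m n`, for `m ∈ ℤ` and `n ≥ 0`, are the coefficients in the expansion
`q^(k/24) (ζ^(1/2) - ζ^(-1/2)) h_k(w; τ) = ∑_{n ≥ 0, m ∈ ℤ} a m n ζ^m q^n`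
on the domain `|ζ q| < 1`, `|ζ⁻¹ q| < 1` (with absolute convergence of the double series). At
`ζ = 1` the left-hand side is a product of a zero and a pole, so that this removable
singularity is left out. -/
def IsCoeff (k : ℕ) (a : ℤ → ℕ → ℂ) : Prop :=
  ∀ w τ : ℂ, 0 < τ.im → ‖e w * e τ‖ < 1 → ‖(e w)⁻¹ * e τ‖ < 1 → e w ≠ 1 →
    HasSum (fun p : ℤ × ℕ => a p.1 p.2 * e w ^ p.1 * e τ ^ p.2)
      (e (k * τ / 24) * (e (w / 2) - e (-w / 2)) * h k w τ)

/-- The false theta function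
`ϑ_m(q) = (1 + q^|m|) ∑_{n ≥ 0} (-1)^n q^(n(n+1)/2 + n|m|) - 1`, for `|q| < 1`. -/
def falseTheta (m : ℤ) (q : ℂ) : ℂ :=
  (1 + q ^ m.natAbs) * (∑' n : ℕ, (-1) ^ n * q ^ (n * (n + 1) / 2 + n * m.natAbs)) - 1

/-- The sector `Re z > 0`, `|Im z| ≤ C Re z`. -/
def sector (C : ℝ) : Set ℂ := {z | 0 < z.re ∧ |z.im| ≤ C * z.re}

/-- `d ℓ`, for `ℓ ≥ 1`, are the coefficients of the asymptotic Taylor expansion at `z = 0` of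
`q^(k/24) ϑ_m(q)`, where `q = exp(-z)`: for every `N ≥ 1`,
`q^(k/24) ϑ_m(q) = ∑_{ℓ=1}^N d ℓ z^ℓ + O(z^(N+1))`
as `z → 0` in any sector `|Im z| ≤ C Re z` of the right half-plane.
There is no constant term, which is recorded as `d 0 = 0`. -/
def IsTaylorCoeff (m : ℤ) (k : ℕ) (d : ℕ → ℂ) : Prop :=
  d 0 = 0 ∧ ∀ N : ℕ, 1 ≤ N → ∀ C : ℝ,
    (fun z : ℂ => Complex.exp (-(k * z / 24)) * falseTheta m (Complex.exp (-z))
      - ∑ ℓ ∈ Finset.Icc 1 N, d ℓ * z ^ ℓ) =O[𝓝[sector C] 0] fun z : ℂ => z ^ (N + 1)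

/-- The modified Bessel function of the first kind of real order `ν` at `x > 0`,
`I_ν(x) = ∑_{j ≥ 0} (x/2)^(2j+ν) / (j! Γ(ν+j+1))`. (Mathlib's `Γ` is `0` at its poles, so that
`1/Γ` has there its correct value `0`.) -/
def besselI (ν x : ℝ) : ℝ :=
  ∑' j : ℕ, (x / 2) ^ (2 * (j : ℝ) + ν) / ((j.factorial : ℝ) * Real.Gamma (ν + j + 1))

/-- The factor
`n^(-(2+2ℓ+k)/4) (π √(k/6))^(1+ℓ+k/2) I_{-1-ℓ-k/2}(π √(2kn/3))`. -/
def mainFactor (k ℓ n : ℕ) : ℝ :=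
  (n : ℝ) ^ (-(2 + 2 * (ℓ : ℝ) + k) / 4)
    * (Real.pi * √((k : ℝ) / 6)) ^ (1 + (ℓ : ℝ) + (k : ℝ) / 2)
    * besselI (-1 - (ℓ : ℝ) - (k : ℝ) / 2) (Real.pi * √(2 * (k : ℝ) * n / 3))

end

end InverseTheta

/-!
The proof is Wright's circle method, applied for each fixed `m` to the generating function
`F_m(q) = ∑_n a_{m,k}(n) q^n`.

**The generating function.** By the product formula for `θ₁`, the left-hand side of the defining
expansion is `1 / ((q; q)_∞^(k-2) (ζ q; q)_∞ (ζ⁻¹ q; q)_∞)` (`mul_h_eq`). Euler's expansion of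
`1 / (x; q)_∞` gives its Laurent coefficients in `ζ` as basic hypergeometric series
(`crankSeries`), and these satisfy the same three-term recurrence in `|m|`, with the same limit, as
combinations of partial theta functions (`crankSeries_eq`). Hence `F_m(q) = ϑ_m(q) / (q; q)_∞^k`
(`hasSum_falseTheta_mul_zpow`), and the double series converges absolutely by Cauchy's estimates
(`isCoeff_coeff`). The coefficients are unique by Fourier orthogonality, first in `ζ` on `|ζ| = 1`,
then in `q` on a circle (`IsCoeff.unique`).

**The Taylor expansion.** Euler's transformation of the alternating series `∑ (-1)^n f(n)`, with
`f(w) = exp(-z (w(w+1)/2 + w r))`, replaces it by a finite sum of differences of `f` at `0`, which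
is entire in `z`, plus an alternating sum of `J`-th differences. Since `f` varies on the scale
`|z|^(-1/2)`, Cauchy's estimates bound that remainder by `O(|z|^((J-1)/2))` in each sector
(`exists_partialTheta_approx`). This yields the coefficients `d_{m,k}(ℓ)`
(`exists_isTaylorCoeff`).

**The circle method.** Put `q = e^(-z)`, `z = x + i y`, and `A = k π² / 6`. By the transformation
law of the eta function, `F_m(e^(-z))` is `(2π)^(-k/2) z^(k/2) e^(A/z)` times a function with the
expansion `∑ d_{m,k}(ℓ) z^ℓ` in sectors (`genFun_exp_neg`, `bracket_isBigO`). In the coefficient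
integral over `|y| ≤ π` take `x = √(A / n)`, the saddle point, where `e^(A/x + n x) = e^(2√(A n))`
and `2√(A n) = π √(2kn/3)`.
* For `2πx ≤ |y| ≤ π`, comparison of `(q; q)_∞` with `(|q|; |q|)_∞` shows that `F_m` is smaller than
  `e^(A/x)` by a factor exponential in `-1/x` (`norm_inv_eulerProd_le_minor`), so that this part is
  negligible (`coeff_sub_arc_isBigO`).
* For `|y| ≤ 2πx` the point `z` stays in a fixed sector, and the expansion may be inserted
  (`arc_sub_sum_isBigO`). The integrals of `z^(ℓ+k/2) e^(A/z + n z)` are, up to smaller exponentials,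
  the Bessel functions of the theorem (`norm_tsum_besselTerm_sub_le`): the Bessel series arises
  from Hankel's formula for `1 / Γ` on a vertical line, applied to the powers of `A / z`.
-/

namespace InverseTheta

noncomputable section

/-! ### Euler's expansion of `1 / (x; q)_∞` -/

/-- The infinite product `(x; q)_∞ = ∏_{n ≥ 0} (1 - x q^n)`. -/
def qPoch (x q : ℂ) : ℂ := ∏' n : ℕ, (1 - x * q ^ n)

/-- The finite product `(q; q)_n = ∏_{i = 1}^n (1 - q^i)`. -/
def qFact (q : ℂ) (n : ℕ) : ℂ := ∏ i ∈ Finset.range n, (1 - q ^ (i + 1))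

/-- The infinite product `(q; q)_∞ = ∏_{n ≥ 1} (1 - q^n)`. -/
def eulerProd (q : ℂ) : ℂ := ∏' n : ℕ, (1 - q ^ (n + 1))

lemma eulerProd_eq_qPoch (q : ℂ) : eulerProd q = qPoch q q := by
  simp [eulerProd, qPoch, pow_succ']

section
variable {q : ℂ}

lemma summable_norm_mul_pow (hq : ‖q‖ < 1) (x : ℂ) : Summable fun n : ℕ => ‖-(x * q ^ n)‖ := by
  simpa using (summable_geometric_of_lt_one (norm_nonneg q) hq).mul_left ‖x‖

lemma multipliable_qPoch (hq : ‖q‖ < 1) (x : ℂ) : Multipliable fun n : ℕ => 1 - x * q ^ n := by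
  simpa [sub_eq_add_neg] using multipliable_one_add_of_summable (summable_norm_mul_pow hq x)

lemma norm_pow_succ_lt_one (hq : ‖q‖ < 1) (n : ℕ) : ‖q ^ (n + 1)‖ < 1 := by
  rw [norm_pow]; exact pow_lt_one₀ (norm_nonneg _) hq (by simp)

lemma one_sub_ne_zero_of_norm_lt_one {x : ℂ} (hx : ‖x‖ < 1) : 1 - x ≠ 0 := by
  intro h
  rw [← sub_eq_zero.mp h] at hx
  simp at hx

lemma qPoch_ne_zero (hq : ‖q‖ < 1) {x : ℂ} (hx : ‖x‖ < 1) : qPoch x q ≠ 0 := by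
  unfold qPoch
  simp_rw [sub_eq_add_neg]
  refine tprod_one_add_ne_zero_of_summable (fun n => ?_) (summable_norm_mul_pow hq x)
  rw [← sub_eq_add_neg]
  apply one_sub_ne_zero_of_norm_lt_one
  rw [norm_mul, norm_pow]
  exact mul_lt_one_of_nonneg_of_lt_one_left (norm_nonneg _) hx (pow_le_one₀ (norm_nonneg _) hq.le)

lemma eulerProd_ne_zero (hq : ‖q‖ < 1) : eulerProd q ≠ 0 := by
  rw [eulerProd_eq_qPoch]; exact qPoch_ne_zero hq hq

lemma qPoch_eq_one_sub_mul (hq : ‖q‖ < 1) (x : ℂ) : qPoch x q = (1 - x) * qPoch (x * q) q := by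
  unfold qPoch
  rw [tprod_eq_zero_mul']
  · simp [pow_succ', mul_assoc]
  · simpa [pow_succ', mul_assoc] using multipliable_qPoch hq (x * q)

lemma qFact_ne_zero (hq : ‖q‖ < 1) (n : ℕ) : qFact q n ≠ 0 :=
  Finset.prod_ne_zero_iff.mpr fun i _ =>
    one_sub_ne_zero_of_norm_lt_one (norm_pow_succ_lt_one hq i)

lemma qFact_succ (n : ℕ) : qFact q (n + 1) = qFact q n * (1 - q ^ (n + 1)) :=
  Finset.prod_range_succ _ _

lemma tendsto_qFact (hq : ‖q‖ < 1) : Tendsto (qFact q) atTop (𝓝 (eulerProd q)) :=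
  (ModularForm.multipliable_one_sub_pow hq).tendsto_prod_tprod_nat

lemma exists_norm_inv_qFact_le (hq : ‖q‖ < 1) : ∃ B, 0 ≤ B ∧ ∀ n, ‖(qFact q n)⁻¹‖ ≤ B := by
  obtain ⟨B, hB⟩ := ((tendsto_qFact hq).inv₀ (eulerProd_ne_zero hq)).norm.bddAbove_range
  exact ⟨B, (norm_nonneg _).trans (hB ⟨0, rfl⟩), fun n => hB ⟨n, rfl⟩⟩

lemma summable_norm_euler (hq : ‖q‖ < 1) {x : ℂ} (hx : ‖x‖ < 1) :
    Summable fun r : ℕ => ‖x ^ r * (qFact q r)⁻¹‖ := by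
  obtain ⟨B, -, hB⟩ := exists_norm_inv_qFact_le hq
  refine Summable.of_nonneg_of_le (fun _ => norm_nonneg _) (fun r => ?_)
    ((summable_geometric_of_lt_one (norm_nonneg x) hx).mul_right B)
  rw [norm_mul, norm_pow]
  gcongr
  exact hB r

lemma tsum_euler_sub (hq : ‖q‖ < 1) {x : ℂ} (hx : ‖x‖ < 1) :
    (1 - x) * ∑' r : ℕ, x ^ r * (qFact q r)⁻¹ = ∑' r : ℕ, (x * q) ^ r * (qFact q r)⁻¹ := by
  have hxq : ‖x * q‖ < 1 := by
    rw [norm_mul]; exact mul_lt_one_of_nonneg_of_lt_one_left (norm_nonneg _) hx hq.le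
  have h1 := (summable_norm_euler hq hx).of_norm
  have h2 := (summable_norm_euler hq hxq).of_norm
  have h3 : ∑' r : ℕ, (x ^ r * (qFact q r)⁻¹ - (x * q) ^ r * (qFact q r)⁻¹)
      = x * ∑' r : ℕ, x ^ r * (qFact q r)⁻¹ := by
    rw [(h1.sub h2).tsum_eq_zero_add, ← tsum_mul_left]
    simp only [pow_zero, sub_self, zero_add]
    refine tsum_congr fun r => ?_
    have := one_sub_ne_zero_of_norm_lt_one (norm_pow_succ_lt_one hq r)
    have := qFact_ne_zero hq r
    rw [qFact_succ]
    field_simp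
    ring
  rw [h1.tsum_sub h2] at h3
  linear_combination h3

/-- Euler's expansion `1 / (x; q)_∞ = ∑_r x^r / (q; q)_r`. -/
lemma qPoch_mul_tsum_euler (hq : ‖q‖ < 1) {x : ℂ} (hx : ‖x‖ < 1) :
    qPoch x q * ∑' r : ℕ, x ^ r * (qFact q r)⁻¹ = 1 := by
  obtain ⟨B, hB0, hB⟩ := exists_norm_inv_qFact_le hq
  have hxn : ∀ n : ℕ, ‖x * q ^ n‖ < 1 := fun n => by
    rw [norm_mul, norm_pow]
    exact mul_lt_one_of_nonneg_of_lt_one_left (norm_nonneg _) hx (pow_le_one₀ (norm_nonneg _) hq.le)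
  have key : ∀ n : ℕ, (∏ i ∈ Finset.range n, (1 - x * q ^ i)) * ∑' r : ℕ, x ^ r * (qFact q r)⁻¹
      = ∑' r : ℕ, (x * q ^ n) ^ r * (qFact q r)⁻¹ := by
    intro n
    induction n with
    | zero => simp
    | succ n ih =>
      rw [Finset.prod_range_succ, mul_right_comm, ih, mul_comm, tsum_euler_sub hq (hxn n)]
      simp [pow_succ, mul_assoc]
  have hlim : Tendsto (fun n : ℕ => ∑' r : ℕ, (x * q ^ n) ^ r * (qFact q r)⁻¹) atTop
      (𝓝 (∑' r : ℕ, (if r = 0 then 1 else 0))) := by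
    refine tendsto_tsum_of_dominated_convergence
      ((summable_geometric_of_lt_one (norm_nonneg x) hx).mul_right B) (fun r => ?_)
      (Eventually.of_forall fun n r => ?_)
    · rcases r with _ | r
      · simp [qFact]
      · have := ((tendsto_pow_atTop_nhds_zero_of_norm_lt_one hq).const_mul x).pow (r + 1)
        simpa using this.mul_const (qFact q (r + 1))⁻¹
    · rw [norm_mul, norm_pow]
      gcongr
      · rw [norm_mul, norm_pow]
        exact mul_le_of_le_one_right (norm_nonneg _) (pow_le_one₀ (norm_nonneg _) hq.le)
      · exact hB r
  have h1 := ((multipliable_qPoch hq x).tendsto_prod_tprod_nat).mul_const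
    (∑' r : ℕ, x ^ r * (qFact q r)⁻¹)
  simp_rw [key] at h1
  rw [tsum_ite_eq] at hlim
  exact tendsto_nhds_unique h1 hlim

/-! ### Laurent coefficients of the crank product -/

/-- The series `∑_s q^(2s) / ((q; q)_s (q; q)_{s+m})`; multiplied by `q^m` it is the coefficient
of `ζ^{±m}` in `1 / ((ζ q; q)_∞ (ζ⁻¹ q; q)_∞)`. -/
def crankSeries (q : ℂ) (m : ℕ) : ℂ := ∑' s : ℕ, q ^ (2 * s) * ((qFact q s)⁻¹ * (qFact q (s + m))⁻¹)

lemma exists_bound_inv_qFact_mul (hq : ‖q‖ < 1) :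
    ∃ B, 0 ≤ B ∧ ∀ s t, ‖(qFact q s)⁻¹ * (qFact q t)⁻¹‖ ≤ B := by
  obtain ⟨B, hB0, hB⟩ := exists_norm_inv_qFact_le hq
  refine ⟨B * B, by positivity, fun s t => ?_⟩
  rw [norm_mul]
  exact mul_le_mul (hB s) (hB t) (norm_nonneg _) hB0

lemma summable_pow_mul_inv_qFact (hq : ‖q‖ < 1) {b : ℕ} (hb : b ≠ 0) (m : ℕ) :
    Summable fun s : ℕ => q ^ (b * s) * ((qFact q s)⁻¹ * (qFact q (s + m))⁻¹) := by
  obtain ⟨B, -, hB⟩ := exists_bound_inv_qFact_mul hq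
  refine Summable.of_norm_bounded (g := fun s : ℕ => (‖q‖ ^ b) ^ s * B)
    ((summable_geometric_of_lt_one (by positivity)
      (pow_lt_one₀ (norm_nonneg _) hq hb)).mul_right B) fun s => ?_
  rw [norm_mul, norm_pow, pow_mul]
  gcongr
  exact hB _ _

/-- With `c_m = crankSeries q m` and `X = ∑_s q^(3s) / ((q; q)_s (q; q)_{s+m+1})`, one has
`c_m = c_{m+1} - q^(m+1) X` and `q² c_{m+2} = c_{m+1} - X`; the recurrence eliminates `X`. -/
lemma crankSeries_rec (hq : ‖q‖ < 1) (m : ℕ) :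
    crankSeries q m =
      (1 - q ^ (m + 1)) * crankSeries q (m + 1) + q ^ (m + 3) * crankSeries q (m + 2) := by
  have hs := fun m => summable_pow_mul_inv_qFact hq two_ne_zero m
  set X := ∑' s : ℕ, q ^ (3 * s) * ((qFact q s)⁻¹ * (qFact q (s + (m + 1)))⁻¹) with hX
  have hX' := summable_pow_mul_inv_qFact hq three_ne_zero (m + 1)
  have h1 : crankSeries q m = crankSeries q (m + 1) - q ^ (m + 1) * X := by
    rw [crankSeries, crankSeries, hX, ← tsum_mul_left, ← (hs (m + 1)).tsum_sub (hX'.mul_left _)]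
    refine tsum_congr fun s => ?_
    have h := one_sub_ne_zero_of_norm_lt_one (norm_pow_succ_lt_one hq (s + m))
    have := qFact_ne_zero hq (s + m)
    have := qFact_ne_zero hq s
    rw [← add_assoc, qFact_succ]
    field_simp
    ring
  have h2 : q ^ 2 * crankSeries q (m + 2) = crankSeries q (m + 1) - X := by
    rw [crankSeries, crankSeries, hX, ← tsum_mul_left, ← (hs (m + 1)).tsum_sub hX',
      ((hs (m + 1)).sub hX').tsum_eq_zero_add]
    simp only [mul_zero, pow_zero, sub_self, zero_add]
    refine tsum_congr fun s => ?_
    have h := one_sub_ne_zero_of_norm_lt_one (norm_pow_succ_lt_one hq s)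
    have := qFact_ne_zero hq (s + 1 + (m + 1))
    have := qFact_ne_zero hq s
    rw [show s + (m + 2) = s + 1 + (m + 1) by ring, qFact_succ]
    field_simp
    ring
  linear_combination h1 - q ^ (m + 1) * h2

lemma tendsto_crankSeries (hq : ‖q‖ < 1) :
    Tendsto (crankSeries q) atTop (𝓝 ((1 - q) / eulerProd q ^ 2)) := by
  obtain ⟨B, -, hB⟩ := exists_bound_inv_qFact_mul hq
  have hq2 : ‖q * q‖ < 1 := by
    rw [norm_mul]; exact mul_lt_one_of_nonneg_of_lt_one_left (norm_nonneg _) hq hq.le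
  have h0 := eulerProd_ne_zero hq
  have hE := qPoch_mul_tsum_euler hq hq2
  have hP := qPoch_eq_one_sub_mul hq q
  rw [← eulerProd_eq_qPoch] at hP
  have hval : (1 - q) / eulerProd q ^ 2
      = ∑' s : ℕ, q ^ (2 * s) * ((qFact q s)⁻¹ * (eulerProd q)⁻¹) := by
    simp_rw [← mul_assoc, pow_mul]
    rw [tsum_mul_right, pow_two q, div_eq_iff (pow_ne_zero 2 h0), mul_assoc, pow_two,
      inv_mul_cancel_left₀ h0]
    linear_combination (-(1 - q)) * hE - (∑' r : ℕ, (q * q) ^ r * (qFact q r)⁻¹) * hP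
  rw [hval]
  refine tendsto_tsum_of_dominated_convergence
      ((summable_geometric_of_lt_one (r := ‖q‖ ^ 2) (by positivity)
      (pow_lt_one₀ (norm_nonneg _) hq two_ne_zero)).mul_right B) (fun s => ?_)
      (Eventually.of_forall fun n s => ?_)
  · refine Tendsto.const_mul _ (Tendsto.const_mul _ (Tendsto.inv₀ ?_ h0))
    exact (tendsto_qFact hq).comp (tendsto_add_atTop_nat s |>.congr fun n => by ring)
  · rw [norm_mul, norm_pow, pow_mul]
    gcongr
    exact hB _ _

/-! ### Partial and false theta functions -/

/-- The partial theta function `∑_{n ≥ 0} (-1)^n q^(n(n+1)/2 + n r)`. -/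
def partialTheta (r : ℕ) (q : ℂ) : ℂ := ∑' n : ℕ, (-1) ^ n * q ^ (n * (n + 1) / 2 + n * r)

lemma norm_partialTheta_term_le (hq : ‖q‖ ≤ 1) (r n : ℕ) :
    ‖(-1) ^ n * q ^ (n * (n + 1) / 2 + n * r)‖ ≤ ‖q‖ ^ n := by
  rw [norm_mul, norm_pow, norm_neg, norm_one, one_pow, one_mul, norm_pow]
  refine pow_le_pow_of_le_one (norm_nonneg _) hq ?_
  have : n ≤ n * (n + 1) / 2 := by
    rw [Nat.le_div_iff_mul_le two_pos]
    rcases n with _ | n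
    · simp
    · nlinarith
  exact this.trans (Nat.le_add_right _ _)

lemma summable_partialTheta (hq : ‖q‖ < 1) (r : ℕ) :
    Summable fun n : ℕ => (-1) ^ n * q ^ (n * (n + 1) / 2 + n * r) :=
  Summable.of_norm_bounded (summable_geometric_of_lt_one (norm_nonneg q) hq)
    (norm_partialTheta_term_le hq.le r)

lemma norm_partialTheta_le (hq : ‖q‖ < 1) (r : ℕ) : ‖partialTheta r q‖ ≤ (1 - ‖q‖)⁻¹ :=
  tsum_of_norm_bounded (hasSum_geometric_of_lt_one (norm_nonneg q) hq)
    (norm_partialTheta_term_le hq.le r)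

lemma partialTheta_rec (hq : ‖q‖ < 1) (r : ℕ) :
    partialTheta r q = 1 - q ^ (r + 1) * partialTheta (r + 1) q := by
  rw [partialTheta, (summable_partialTheta hq r).tsum_eq_zero_add, partialTheta, ← tsum_mul_left,
    sub_eq_add_neg, ← tsum_neg]
  congr 1
  · simp
  · refine tsum_congr fun n => ?_
    have : (n + 1) * (n + 1 + 1) / 2 + (n + 1) * r = (r + 1) + (n * (n + 1) / 2 + n * (r + 1)) := by
      have : (n + 1) * (n + 1 + 1) = n * (n + 1) + (n + 1) * 2 := by ring
      rw [this, Nat.add_mul_div_right _ _ two_pos]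
      ring
    rw [this, pow_add q (r + 1), pow_succ]
    ring

lemma tendsto_partialTheta (hq : ‖q‖ < 1) :
    Tendsto (fun r => partialTheta r q) atTop (𝓝 1) := by
  have h : Tendsto (fun r => q ^ (r + 1) * partialTheta (r + 1) q) atTop (𝓝 0) := by
    refine squeeze_zero_norm (a := fun r => ‖q‖ ^ (r + 1) * (1 - ‖q‖)⁻¹) (fun r => ?_) ?_
    · rw [norm_mul, norm_pow]
      gcongr
      exact norm_partialTheta_le hq _
    · have := (tendsto_pow_atTop_nhds_zero_of_lt_one (norm_nonneg q) hq).comp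
        (tendsto_add_atTop_nat 1)
      simpa using this.mul_const (1 - ‖q‖)⁻¹
  have := h.const_sub 1
  simp_rw [← partialTheta_rec hq] at this
  simpa using this

lemma falseTheta_eq_partialTheta (m : ℤ) (q : ℂ) :
    falseTheta m q = (1 + q ^ m.natAbs) * partialTheta m.natAbs q - 1 := rfl

/-- The cancellation of the constant term `-1`, which exhibits the factor `q^|m|`. -/
lemma falseTheta_eq_pow_mul (hq : ‖q‖ < 1) (m : ℤ) :
    falseTheta m q
      = q ^ m.natAbs * (partialTheta m.natAbs q - q * partialTheta (m.natAbs + 1) q) := by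
  rw [falseTheta_eq_partialTheta]
  linear_combination partialTheta_rec hq m.natAbs

lemma norm_falseTheta_le (hq : ‖q‖ < 1) (m : ℤ) :
    ‖falseTheta m q‖ ≤ 2 * (1 - ‖q‖)⁻¹ * ‖q‖ ^ m.natAbs := by
  have h0 : 0 ≤ (1 - ‖q‖)⁻¹ := inv_nonneg.mpr (by linarith)
  rw [falseTheta_eq_pow_mul hq, norm_mul, norm_pow, mul_comm]
  gcongr
  calc _ ≤ ‖partialTheta m.natAbs q‖ + ‖q‖ * ‖partialTheta (m.natAbs + 1) q‖ := by
        rw [← norm_mul]; exact norm_sub_le _ _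
    _ ≤ (1 - ‖q‖)⁻¹ + 1 * (1 - ‖q‖)⁻¹ := by
        gcongr
        · exact norm_partialTheta_le hq _
        · exact norm_partialTheta_le hq _
    _ = _ := by ring

/-- A solution tending to `0` of the three-term recurrence shared by `crankSeries` and the false
theta functions vanishes: multiplied by `∏_{i ≤ j} (1 + 2 |q|^i)`, its absolute values `w j`
satisfy `w j ≤ max (w (j + 1)) (w (j + 2))` and still tend to `0`. -/
lemma eq_zero_of_rec_of_tendsto (hq : ‖q‖ < 1) {u : ℕ → ℂ}
    (hrec : ∀ m, u m = (1 - q ^ (m + 1)) * u (m + 1) + q ^ (m + 3) * u (m + 2))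
    (hlim : Tendsto u atTop (𝓝 0)) (m : ℕ) : u m = 0 := by
  set P : ℕ → ℝ := fun j => ∏ i ∈ Finset.range j, (1 + 2 * ‖q‖ ^ (i + 1)) with hP
  have hPs : ∀ j, P (j + 1) = P j * (1 + 2 * ‖q‖ ^ (j + 1)) := fun j => Finset.prod_range_succ _ _
  have hP0 : ∀ j, 1 ≤ P j := fun j => by
    induction j with
    | zero => simp [hP]
    | succ j ih =>
      rw [hPs]
      exact one_le_mul_of_one_le_of_one_le ih (by linarith [pow_nonneg (norm_nonneg q) (j + 1)])
  have hPm : ∀ j, P j ≤ P (j + 1) := fun j => by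
    rw [hPs]
    exact le_mul_of_one_le_right (by linarith [hP0 j]) (by linarith [pow_nonneg (norm_nonneg q) (j + 1)])
  have hmul : Multipliable fun i : ℕ => 1 + 2 * ‖q‖ ^ (i + 1) := by
    apply multipliable_one_add_of_summable
    have := ((summable_nat_add_iff 1).mpr
      (summable_geometric_of_lt_one (norm_nonneg q) hq)).mul_left 2
    simpa using this
  have hw0 : Tendsto (fun j => ‖u j‖ * P j) atTop (𝓝 0) := by
    simpa using hlim.norm.mul hmul.tendsto_prod_tprod_nat
  set w : ℕ → ℝ := fun j => ‖u j‖ * P j with hw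
  have hwstep : ∀ j, w j ≤ max (w (j + 1)) (w (j + 2)) := by
    intro j
    set M := max (w (j + 1)) (w (j + 2)) with hM
    have hPj : 0 < P (j + 1) := by linarith [hP0 (j + 1)]
    have h1 : ‖u (j + 1)‖ ≤ M / P (j + 1) := by
      rw [le_div_iff₀ hPj]; exact le_max_left _ _
    have h2 : ‖u (j + 2)‖ ≤ M / P (j + 1) := by
      rw [le_div_iff₀ hPj]
      exact (mul_le_mul_of_nonneg_left (hPm (j + 1)) (norm_nonneg _)).trans (le_max_right _ _)
    have hM0 : 0 ≤ M / P (j + 1) := (norm_nonneg _).trans h1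
    have h3 : ‖u j‖ ≤ (1 + 2 * ‖q‖ ^ (j + 1)) * (M / P (j + 1)) := by
      rw [hrec j]
      refine (norm_add_le _ _).trans ?_
      rw [norm_mul, norm_mul, norm_pow]
      have h4 : ‖1 - q ^ (j + 1)‖ ≤ 1 + ‖q‖ ^ (j + 1) := by
        refine (norm_sub_le _ _).trans ?_
        rw [norm_one, norm_pow]
      have h5 : ‖q‖ ^ (j + 3) ≤ ‖q‖ ^ (j + 1) :=
        pow_le_pow_of_le_one (norm_nonneg _) hq.le (by omega)
      calc _ ≤ (1 + ‖q‖ ^ (j + 1)) * (M / P (j + 1)) + ‖q‖ ^ (j + 1) * (M / P (j + 1)) := by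
            gcongr
        _ = _ := by ring
    calc w j ≤ (1 + 2 * ‖q‖ ^ (j + 1)) * (M / P (j + 1)) * P j :=
          mul_le_mul_of_nonneg_right h3 (by linarith [hP0 j])
      _ = M := by rw [mul_right_comm, mul_comm _ (P j), ← hPs]; field_simp
  have hwn : ∀ n, w m ≤ max (w (m + n)) (w (m + n + 1)) := by
    intro n
    induction n with
    | zero => exact le_max_left _ _
    | succ n ih => exact ih.trans (max_le (hwstep _) (le_max_left _ _))
  have hl : Tendsto (fun n => max (w (m + n)) (w (m + n + 1))) atTop (𝓝 (max 0 0)) := by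
    have ha : Tendsto (fun n => m + n) atTop atTop := tendsto_atTop_mono (fun n => by simp only [id]; omega) tendsto_id
    have hb : Tendsto (fun n => m + n + 1) atTop atTop := tendsto_atTop_mono (fun n => by simp only [id]; omega) tendsto_id
    exact (hw0.comp ha).max (hw0.comp hb)
  have hle : w m ≤ 0 := by simpa using ge_of_tendsto' hl hwn
  have : ‖u m‖ ≤ 0 := by
    by_contra h
    have := mul_pos (not_le.mp h) (by linarith [hP0 m] : 0 < P m)
    exact absurd hle (not_le.mpr this)
  exact norm_le_zero_iff.mp this

/-- Both sides solve the recurrence `crankSeries_rec` in `m` and tend to `1 - q`. -/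
lemma crankSeries_eq (hq : ‖q‖ < 1) (m : ℕ) :
    crankSeries q m * eulerProd q ^ 2 = partialTheta m q - q * partialTheta (m + 1) q := by
  refine sub_eq_zero.mp (eq_zero_of_rec_of_tendsto hq (u := fun m => crankSeries q m * eulerProd q ^ 2
    - (partialTheta m q - q * partialTheta (m + 1) q)) (fun m => ?_) ?_ m)
  · have h1 := partialTheta_rec hq m
    have h2 := partialTheta_rec hq (m + 1)
    have h3 := partialTheta_rec hq (m + 2)
    have h4 := crankSeries_rec hq m
    simp only [add_assoc] at h1 h2 h3 h4 ⊢
    norm_num at h1 h2 h3 h4 ⊢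
    linear_combination eulerProd q ^ 2 * h4 - h1 + h2 - q * (-h2 + h3)
  · have h1 := (tendsto_crankSeries hq).mul_const (eulerProd q ^ 2)
    have h2 := tendsto_partialTheta hq
    have h3 := (h2.comp (tendsto_add_atTop_nat 1)).const_mul q
    rw [div_mul_cancel₀ _ (pow_ne_zero 2 (eulerProd_ne_zero hq))] at h1
    simpa using h1.sub (h2.sub h3)

/-- Pairs `(r, s)` of natural numbers, written as the difference `r - s` and `min r s`. -/
def diffMinEquiv : ℤ × ℕ ≃ ℕ × ℕ where
  toFun p := (p.2 + p.1.toNat, p.2 + (-p.1).toNat)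
  invFun p := ((p.1 : ℤ) - p.2, min p.1 p.2)
  left_inv p := by
    ext
    · simp
    · simp only []
      omega
  right_inv p := by ext <;> (simp only []; omega)

/-- The Laurent expansion of `1 / ((ζ q; q)_∞ (ζ⁻¹ q; q)_∞)` in the annulus
`|q| < |ζ| < |q|⁻¹`. -/
lemma hasSum_falseTheta_mul_zpow (hq : ‖q‖ < 1) {ζ : ℂ} (hζ0 : ζ ≠ 0) (h1 : ‖ζ * q‖ < 1)
    (h2 : ‖ζ⁻¹ * q‖ < 1) :
    HasSum (fun m : ℤ => falseTheta m q * ζ ^ m)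
      (eulerProd q ^ 2 / (qPoch (ζ * q) q * qPoch (ζ⁻¹ * q) q)) := by
  have hA := qPoch_mul_tsum_euler hq h1
  have hB := qPoch_mul_tsum_euler hq h2
  have hs := (summable_norm_euler hq h1).of_norm.hasSum.mul
    (summable_norm_euler hq h2).of_norm.hasSum
    (summable_mul_of_summable_norm (f := fun r : ℕ => (ζ * q) ^ r * (qFact q r)⁻¹)
      (g := fun r : ℕ => (ζ⁻¹ * q) ^ r * (qFact q r)⁻¹)
      (summable_norm_euler hq h1) (summable_norm_euler hq h2))
  have hs' : HasSum (fun p : ℤ × ℕ => eulerProd q ^ 2 *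
      ((ζ * q) ^ (p.2 + p.1.toNat) * (qFact q (p.2 + p.1.toNat))⁻¹ *
        ((ζ⁻¹ * q) ^ (p.2 + (-p.1).toNat) * (qFact q (p.2 + (-p.1).toNat))⁻¹))) _ :=
    (diffMinEquiv.hasSum_iff.mpr hs).mul_left (eulerProd q ^ 2)
  have hfib : ∀ m : ℤ, HasSum (fun s : ℕ => eulerProd q ^ 2 *
      ((ζ * q) ^ (s + m.toNat) * (qFact q (s + m.toNat))⁻¹ *
        ((ζ⁻¹ * q) ^ (s + (-m).toNat) * (qFact q (s + (-m).toNat))⁻¹)))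
      (falseTheta m q * ζ ^ m) := by
    intro m
    have hm := (summable_pow_mul_inv_qFact hq two_ne_zero m.natAbs).hasSum.mul_left
      (eulerProd q ^ 2 * q ^ m.natAbs * ζ ^ m)
    have hval : falseTheta m q * ζ ^ m = eulerProd q ^ 2 * q ^ m.natAbs * ζ ^ m *
        ∑' s : ℕ, q ^ (2 * s) * ((qFact q s)⁻¹ * (qFact q (s + m.natAbs))⁻¹) := by
      rw [falseTheta_eq_pow_mul hq, ← crankSeries_eq hq, crankSeries]
      ring
    rw [hval]
    refine hm.congr_fun fun s => ?_
    rcases Int.eq_nat_or_neg m with ⟨a, rfl | rfl⟩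
    · simp only [Int.toNat_natCast, Int.toNat_neg_natCast, add_zero, Int.natAbs_natCast,
        zpow_natCast]
      have : ζ ^ (s + a) * ζ⁻¹ ^ s = ζ ^ a := by
        rw [pow_add, inv_pow]; field_simp
      rw [mul_pow, mul_pow, ← this]
      ring
    · simp only [Int.toNat_natCast, Int.toNat_neg_natCast, add_zero, Int.natAbs_natCast,
        zpow_neg, zpow_natCast, neg_neg, Int.natAbs_neg]
      have : ζ ^ s * ζ⁻¹ ^ (s + a) = (ζ ^ a)⁻¹ := by
        rw [pow_add, inv_pow, inv_pow]; field_simp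
      rw [mul_pow, mul_pow, ← this]
      ring
  convert hs'.prod_fiberwise hfib using 1
  have := left_ne_zero_of_mul_eq_one hA
  have := left_ne_zero_of_mul_eq_one hB
  rw [div_eq_iff (by positivity)]
  linear_combination (-eulerProd q ^ 2) * hA
    - eulerProd q ^ 2 * (qPoch (ζ * q) q * ∑' r : ℕ, (ζ * q) ^ r * (qFact q r)⁻¹) * hB

end

/-! ### The product formula for `h_k` -/

lemma e_ne_zero (x : ℂ) : e x ≠ 0 := Complex.exp_ne_zero _

lemma e_add (x y : ℂ) : e (x + y) = e x * e y := by
  rw [e, e, e, ← Complex.exp_add]; ring_nf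

lemma e_neg (x : ℂ) : e (-x) = (e x)⁻¹ := by
  rw [e, e, ← Complex.exp_neg]; ring_nf

lemma e_nat_mul (n : ℕ) (x : ℂ) : e (n * x) = e x ^ n := by
  rw [e, e, ← Complex.exp_nat_mul]; ring_nf

lemma norm_e (x : ℂ) : ‖e x‖ = Real.exp (-2 * Real.pi * x.im) := by
  rw [e, Complex.norm_exp]
  simp

lemma norm_e_lt_one {τ : ℂ} (hτ : 0 < τ.im) : ‖e τ‖ < 1 := by
  rw [norm_e, Real.exp_lt_one_iff]
  nlinarith [Real.pi_pos, mul_pos Real.pi_pos hτ]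

lemma eta_eq_e_mul_eulerProd (τ : ℂ) : ModularForm.eta τ = e (τ / 24) * eulerProd (e τ) := by
  rw [ModularForm.eta, eulerProd]
  congr 1
  · rw [Function.Periodic.qParam, e]
    congr 1
    push_cast
    ring
  · simp_rw [ModularForm.eta_q_eq_pow, e]

lemma theta1_eq {w τ : ℂ} (hτ : 0 < τ.im) : theta1 w τ = Complex.I * e (w / 2) * e (τ / 8) *
    (eulerProd (e τ) * qPoch (e w * e τ) (e τ) *
      ((1 - (e w)⁻¹) * qPoch ((e w)⁻¹ * e τ) (e τ))) := by
  have hq := norm_e_lt_one hτ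
  have h1 := ModularForm.multipliable_one_sub_pow hq
  have h2 := multipliable_qPoch hq (e w * e τ)
  have h3 := multipliable_qPoch hq (e w)⁻¹
  rw [theta1, ← qPoch_eq_one_sub_mul hq, eulerProd, qPoch, qPoch, ← h1.tprod_mul h2,
    ← (h1.mul h2).tprod_mul h3]
  simp_rw [pow_succ', mul_assoc]

/-- The left-hand side of the expansion defining `a_{m,k}(n)` is
`1 / ((q; q)_∞^(k-2) (ζ q; q)_∞ (ζ⁻¹ q; q)_∞)`. -/
lemma mul_h_eq (k : ℕ) {w τ : ℂ} (hτ : 0 < τ.im) (h1 : ‖e w * e τ‖ < 1)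
    (h2 : ‖(e w)⁻¹ * e τ‖ < 1) (hw : e w ≠ 1) :
    e (k * τ / 24) * (e (w / 2) - e (-w / 2)) * h k w τ
      = eulerProd (e τ) ^ 2 / (qPoch (e w * e τ) (e τ) * qPoch ((e w)⁻¹ * e τ) (e τ))
        / eulerProd (e τ) ^ k := by
  have hq := norm_e_lt_one hτ
  have hE := eulerProd_ne_zero hq
  have hA := qPoch_ne_zero hq h1
  have hB := qPoch_ne_zero hq h2
  have ht := e_ne_zero (τ / 24)
  have hs := e_ne_zero (w / 2)
  have hw2 : e w = e (w / 2) ^ 2 := by rw [← e_nat_mul]; congr 1; push_cast; ring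
  have hne : 1 - (e w)⁻¹ ≠ 0 := by
    rw [sub_ne_zero, ne_eq, eq_comm, inv_eq_one]; exact hw
  rw [h, theta1_eq hτ, eta_eq_e_mul_eulerProd, zpow_sub₀ (mul_ne_zero ht hE),
    show e (k * τ / 24) = e (τ / 24) ^ k by rw [← e_nat_mul, mul_div_assoc],
    show e (τ / 8) = e (τ / 24) ^ 3 by rw [← e_nat_mul]; congr 1; push_cast; ring,
    show e (w / 2) - e (-w / 2) = e (w / 2) * (1 - (e w)⁻¹) by
      rw [neg_div, e_neg, hw2]; field_simp]
  generalize qPoch (e w * e τ) (e τ) = A at *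
  generalize qPoch ((e w)⁻¹ * e τ) (e τ) = B at *
  generalize 1 - (e w)⁻¹ = W at *
  generalize e (w / 2) = s at *
  generalize e (τ / 24) = t at *
  generalize eulerProd (e τ) = E at *
  have hI := Complex.I_ne_zero
  norm_cast
  rw [mul_pow, mul_pow]
  field_simp

/-! ### The coefficients: existence and uniqueness -/

/-- The generating function `∑_n a_{m,k}(n) q^n = ϑ_m(q) / (q; q)_∞^k`. -/
def genFun (k : ℕ) (m : ℤ) (q : ℂ) : ℂ := falseTheta m q / eulerProd q ^ k

lemma differentiableOn_partialTheta (r : ℕ) :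
    DifferentiableOn ℂ (partialTheta r) (Metric.ball 0 1) := by
  intro q hq
  obtain ⟨R, hqR, hR⟩ := exists_between (mem_ball_zero_iff.mp hq)
  have hR0 : 0 ≤ R := (norm_nonneg q).trans hqR.le
  have h : DifferentiableOn ℂ (partialTheta r) (Metric.ball 0 R) := by
    refine Complex.differentiableOn_tsum_of_summable_norm (summable_geometric_of_lt_one hR0 hR)
      (fun n => by fun_prop) Metric.isOpen_ball fun n x hx => ?_
    rw [mem_ball_zero_iff] at hx
    refine (norm_partialTheta_term_le (hx.trans hR).le r n).trans ?_
    gcongr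
  exact (h.differentiableAt (Metric.isOpen_ball.mem_nhds
    (mem_ball_zero_iff.mpr hqR))).differentiableWithinAt

lemma differentiableOn_falseTheta (m : ℤ) :
    DifferentiableOn ℂ (falseTheta m) (Metric.ball 0 1) := by
  have := differentiableOn_partialTheta m.natAbs
  have h : falseTheta m = fun q => (1 + q ^ m.natAbs) * partialTheta m.natAbs q - 1 := rfl
  rw [h]
  fun_prop

lemma differentiableOn_genFun (k : ℕ) (m : ℤ) :
    DifferentiableOn ℂ (genFun k m) (Metric.ball 0 1) :=
  (differentiableOn_falseTheta m).div (ModularForm.differentiableOn_tprod_one_sub_pow.pow k)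
    fun _ hq => pow_ne_zero _ (eulerProd_ne_zero (mem_ball_zero_iff.mp hq))

/-- The coefficient of `q^n` in `ϑ_m(q) / (q; q)_∞^k`. -/
def coeff (k : ℕ) (m : ℤ) (n : ℕ) : ℂ := (n.factorial : ℂ)⁻¹ * iteratedDeriv n (genFun k m) 0

lemma hasSum_coeff (k : ℕ) (m : ℤ) {q : ℂ} (hq : ‖q‖ < 1) :
    HasSum (fun n => coeff k m n * q ^ n) (genFun k m q) := by
  refine (Complex.hasSum_taylorSeries_on_ball (differentiableOn_genFun k m)
    (mem_ball_zero_iff.mpr hq)).congr_fun fun n => ?_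
  simp only [coeff, sub_zero, smul_eq_mul]
  ring

/-- Cauchy's estimate on the circle `|q| = R`, uniformly in `m`; the factor `R^|m|`, inherited from
the false theta function, makes the sum over `m` converge. -/
lemma exists_norm_coeff_le (k : ℕ) {R : ℝ} (hR0 : 0 < R) (hR1 : R < 1) :
    ∃ K, ∀ (m : ℤ) (n : ℕ), ‖coeff k m n‖ ≤ K * R ^ m.natAbs * R⁻¹ ^ n := by
  have hsub : Metric.closedBall (0 : ℂ) R ⊆ Metric.ball 0 1 := Metric.closedBall_subset_ball hR1
  have hcont : ContinuousOn (fun q => (eulerProd q ^ k)⁻¹) (Metric.closedBall 0 R) := by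
    refine ContinuousOn.inv₀ ?_ fun q hq =>
      pow_ne_zero _ (eulerProd_ne_zero (mem_ball_zero_iff.mp (hsub hq)))
    exact (ModularForm.differentiableOn_tprod_one_sub_pow.continuousOn.mono hsub).pow k
  obtain ⟨D, hD⟩ := (isCompact_closedBall (0 : ℂ) R).exists_bound_of_continuousOn hcont
  refine ⟨2 * (1 - R)⁻¹ * D, fun m n => ?_⟩
  have h := Complex.norm_iteratedDeriv_le_of_forall_mem_sphere_norm_le (c := (0 : ℂ))
    (f := genFun k m) (C := 2 * (1 - R)⁻¹ * R ^ m.natAbs * D) n hR0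
    (((differentiableOn_genFun k m).mono hsub).diffContOnCl_ball subset_rfl) (fun z hz => by
      have hz' : ‖z‖ = R := mem_sphere_zero_iff_norm.mp hz
      rw [genFun, div_eq_mul_inv, norm_mul]
      have hf := norm_falseTheta_le (hz'.trans_lt hR1) m
      rw [hz'] at hf
      exact mul_le_mul hf (hD z (Metric.sphere_subset_closedBall hz)) (norm_nonneg _)
        ((norm_nonneg _).trans hf))
  rw [coeff, norm_mul, norm_inv, Complex.norm_natCast]
  have hn : (0 : ℝ) < n.factorial := by positivity
  calc _ ≤ (n.factorial : ℝ)⁻¹ * (n.factorial * (2 * (1 - R)⁻¹ * R ^ m.natAbs * D) / R ^ n) := by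
        gcongr
    _ = _ := by rw [inv_pow]; field_simp

lemma summable_pow_natAbs_mul_zpow {R : ℝ} (hR0 : 0 ≤ R) {x : ℝ} (hx : 0 < x) (h1 : R * x < 1)
    (h2 : R * x⁻¹ < 1) : Summable fun m : ℤ => R ^ m.natAbs * x ^ m := by
  refine Summable.of_nat_of_neg ?_ ?_
  · simpa [← mul_pow] using summable_geometric_of_lt_one (by positivity) h1
  · refine (summable_geometric_of_lt_one (by positivity) h2).congr fun n => ?_
    simp [mul_pow]

/-- The numbers `coeff k m n` satisfy the defining expansion: the double series converges
absolutely, and summing first over `n` leaves the Laurent series in `ζ`. -/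
lemma isCoeff_coeff (k : ℕ) : IsCoeff k (coeff k) := by
  intro w τ hτ h1 h2 hw
  have hq := norm_e_lt_one hτ
  have hζ := norm_pos_iff.mpr (e_ne_zero w)
  rw [mul_h_eq k hτ h1 h2 hw]
  set q := e τ
  set ζ := e w
  rw [norm_mul] at h1
  rw [norm_mul, norm_inv] at h2
  -- A radius `R` with `|q| < R`, `R |ζ| < 1` and `R |ζ|⁻¹ < 1`.
  obtain ⟨R, hqR, hR⟩ := exists_between (lt_min hq (lt_min ((lt_inv_mul_iff₀ hζ).mpr h1)
    ((lt_inv_mul_iff₀ (inv_pos.mpr hζ)).mpr h2)))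
  simp only [lt_min_iff, mul_one, inv_inv] at hR
  have hR0 : 0 < R := (norm_nonneg q).trans_lt hqR
  obtain ⟨K, hK⟩ := exists_norm_coeff_le k hR0 hR.1
  have hsum : Summable fun p : ℤ × ℕ => coeff k p.1 p.2 * ζ ^ p.1 * q ^ p.2 := by
    have hS1 := summable_pow_natAbs_mul_zpow hR0.le hζ
      (by rw [mul_comm]; exact (lt_inv_mul_iff₀ hζ).mp (by rw [mul_one]; exact hR.2.1))
      (by rw [← div_eq_mul_inv, div_lt_one hζ]; exact hR.2.2)
    have hS2 := summable_geometric_of_lt_one (r := R⁻¹ * ‖q‖) (by positivity)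
      (by rwa [inv_mul_lt_iff₀ hR0, mul_one])
    refine Summable.of_norm_bounded ((hS1.mul_of_nonneg hS2 (fun m => by positivity)
      (fun n => by positivity)).mul_left K) fun p => ?_
    rw [norm_mul, norm_mul, norm_zpow, norm_pow]
    calc _ ≤ K * R ^ p.1.natAbs * R⁻¹ ^ p.2 * ‖ζ‖ ^ p.1 * ‖q‖ ^ p.2 := by
          gcongr
          exact hK _ _
      _ = _ := by rw [mul_pow]; ring
  have hfib : ∀ m : ℤ, HasSum (fun n : ℕ => coeff k m n * ζ ^ m * q ^ n)
      (genFun k m q * ζ ^ m) := fun m => by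
    refine ((hasSum_coeff k m hq).mul_right (ζ ^ m)).congr_fun fun n => by ring
  have h3 := hsum.hasSum.prod_fiberwise hfib
  have h4 := (hasSum_falseTheta_mul_zpow hq (e_ne_zero w) (by rwa [norm_mul])
    (by rwa [norm_mul, norm_inv])).div_const (eulerProd q ^ k)
  have h5 : (fun m : ℤ => falseTheta m q * ζ ^ m / eulerProd q ^ k)
      = fun m => genFun k m q * ζ ^ m := by
    funext m; rw [genFun]; ring
  rw [h5] at h4
  rw [← h3.unique h4]
  exact hsum.hasSum

lemma integral_exp_int_mul_I (n : ℤ) :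
    ∫ t in -Real.pi..Real.pi, Complex.exp (n * t * Complex.I)
      = if n = 0 then 2 * (Real.pi : ℂ) else 0 := by
  split_ifs with hn
  · simp [hn]; ring
  · have hc : (n : ℂ) * Complex.I ≠ 0 := mul_ne_zero (by exact_mod_cast hn) Complex.I_ne_zero
    have := integral_exp_mul_complex (a := -Real.pi) (b := Real.pi) hc
    simp_rw [mul_right_comm _ Complex.I] at this
    rw [this]
    have hp : Complex.exp (n * (Real.pi : ℝ) * Complex.I)
        = Complex.exp (n * ((-Real.pi : ℝ) : ℂ) * Complex.I) := by
      rw [Complex.exp_eq_exp_iff_exists_int]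
      exact ⟨n, by push_cast; ring⟩
    rw [hp, sub_self, zero_div]

/-- The Fourier coefficients of an absolutely convergent trigonometric series. The sum is prescribed
only for `t ≠ 0`, since the expansion defining `a_{m,k}(n)` exempts `ζ = 1`. -/
lemma integral_mul_exp_of_hasSum {ι : Type*} [Countable ι] {φ : ι → ℤ} (hφ : Function.Injective φ)
    {c : ι → ℂ} (hc : Summable fun i => ‖c i‖) {F : ℝ → ℂ}
    (hF : ∀ t ∈ Set.Ioo (-Real.pi) Real.pi, t ≠ 0 →
      HasSum (fun i => c i * Complex.exp (φ i * t * Complex.I)) (F t)) (j : ι) :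
    ∫ t in -Real.pi..Real.pi, F t * Complex.exp (-(φ j * t * Complex.I))
      = 2 * Real.pi * c j := by
  have hae : ∀ᵐ t : ℝ, t ≠ 0 ∧ t ≠ Real.pi := by
    filter_upwards [MeasureTheory.Measure.ae_ne MeasureTheory.volume (0 : ℝ),
      MeasureTheory.Measure.ae_ne MeasureTheory.volume Real.pi] with t h1 h2 using ⟨h1, h2⟩
  have hexp : ∀ (x : ℝ), ‖Complex.exp (x * Complex.I)‖ = 1 := Complex.norm_exp_ofReal_mul_I
  have h := intervalIntegral.hasSum_integral_of_dominated_convergence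
    (μ := MeasureTheory.volume) (a := -Real.pi) (b := Real.pi)
    (F := fun i (t : ℝ) => c i * Complex.exp (((φ i - φ j : ℤ) : ℂ) * t * Complex.I))
    (f := fun t : ℝ => F t * Complex.exp (-(φ j * t * Complex.I))) (fun i _ => ‖c i‖)
    (fun i => Continuous.aestronglyMeasurable (by fun_prop))
    (fun i => Eventually.of_forall fun t _ => by
      rw [norm_mul]
      have := hexp ((φ i - φ j : ℤ) * t)
      push_cast at this ⊢
      rw [this, mul_one])
    (Eventually.of_forall fun t _ => hc) (by simp)
    (by
      filter_upwards [hae] with t ht htI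
      rw [Set.uIoc_of_le (by linarith [Real.pi_pos])] at htI
      refine ((hF t ⟨htI.1, lt_of_le_of_ne htI.2 ht.2⟩ ht.1).mul_right _).congr_fun fun i => ?_
      rw [mul_assoc (c i), ← Complex.exp_add]
      congr 2
      push_cast
      ring)
  simp_rw [intervalIntegral.integral_const_mul, integral_exp_int_mul_I, sub_eq_zero] at h
  have h2 : HasSum (fun i => c i * if φ i = φ j then 2 * (Real.pi : ℂ) else 0)
      (2 * Real.pi * c j) := by
    classical
    have := hasSum_ite_eq (α := ℂ) j (2 * Real.pi * c j)
    refine this.congr_fun fun i => ?_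
    by_cases hi : i = j
    · simp [hi, mul_comm]
    · simp [hi, hφ.eq_iff]
  exact h.unique h2

lemma eq_zero_of_hasSum_exp {ι : Type*} [Countable ι] {φ : ι → ℤ} (hφ : Function.Injective φ)
    {c : ι → ℂ} (hc : Summable fun i => ‖c i‖)
    (hF : ∀ t ∈ Set.Ioo (-Real.pi) Real.pi, t ≠ 0 →
      HasSum (fun i => c i * Complex.exp (φ i * t * Complex.I)) 0) (j : ι) : c j = 0 := by
  have h := integral_mul_exp_of_hasSum hφ hc (F := fun _ => 0) hF j
  simp only [zero_mul, intervalIntegral.integral_zero] at h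
  have := Complex.ofReal_ne_zero.mpr Real.pi_ne_zero
  simpa [this] using h.symm

lemma IsCoeff.unique {k : ℕ} {a b : ℤ → ℕ → ℂ} (ha : IsCoeff k a) (hb : IsCoeff k b) : a = b := by
  -- The circle `|ζ| = 1` lies in the domain for every `τ`; its point `ζ = 1` corresponds to `t = 0`.
  have hsum : ∀ (τ : ℂ), 0 < τ.im → ∀ t ∈ Set.Ioo (-Real.pi) Real.pi, t ≠ 0 →
      HasSum (fun p : ℤ × ℕ => (a p.1 p.2 - b p.1 p.2) * Complex.exp (t * Complex.I) ^ p.1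
        * e τ ^ p.2) 0 := by
    intro τ hτ t ht ht0
    have hpi := Complex.ofReal_ne_zero.mpr Real.pi_ne_zero
    have he : e (t / (2 * Real.pi)) = Complex.exp (t * Complex.I) := by
      rw [e]; congr 1; field_simp
    have hn : ‖e (t / (2 * Real.pi) : ℂ)‖ = 1 := by rw [he]; exact Complex.norm_exp_ofReal_mul_I t
    have hq := norm_e_lt_one hτ
    have h1 : e (t / (2 * Real.pi) : ℂ) ≠ 1 := by
      rw [he, ne_eq, Complex.exp_eq_one_iff]
      rintro ⟨n, hn⟩
      have h2 : (t : ℂ) = n * (2 * Real.pi) := by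
        apply mul_right_cancel₀ Complex.I_ne_zero; rw [hn]; ring
      have h3 : t = n * (2 * Real.pi) := by exact_mod_cast h2
      have hp := Real.pi_pos
      have h4 : (n : ℝ) < 1 := by nlinarith [ht.2]
      have h5 : (-1 : ℝ) < n := by nlinarith [ht.1]
      have h6 : n = 0 := by
        have h4' : n < 1 := by exact_mod_cast h4
        have h5' : -1 < n := by exact_mod_cast h5
        omega
      simp [h6] at h3
      exact ht0 h3
    have hA := ha (t / (2 * Real.pi)) τ hτ (by rwa [norm_mul, hn, one_mul])
      (by rwa [norm_mul, norm_inv, hn, inv_one, one_mul]) h1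
    have hB := hb (t / (2 * Real.pi)) τ hτ (by rwa [norm_mul, hn, one_mul])
      (by rwa [norm_mul, norm_inv, hn, inv_one, one_mul]) h1
    have := hA.sub hB
    rw [sub_self] at this
    refine this.congr_fun fun p => ?_
    rw [he]; ring
  have hnorm : ∀ (τ : ℂ), 0 < τ.im →
      Summable fun p : ℤ × ℕ => ‖(a p.1 p.2 - b p.1 p.2) * e τ ^ p.2‖ := by
    intro τ hτ
    refine (hsum τ hτ 1 ⟨by linarith [Real.pi_pos], by linarith [Real.pi_gt_three]⟩
      one_ne_zero).summable.norm.congr fun p => ?_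
    rw [norm_mul, norm_mul, norm_mul, norm_zpow, Complex.norm_exp_ofReal_mul_I, one_zpow, mul_one]
  -- Orthogonality in `ζ` separates the rows of the double series.
  have hrow : ∀ (τ : ℂ), 0 < τ.im → ∀ m : ℤ, HasSum (fun n => (a m n - b m n) * e τ ^ n) 0 := by
    intro τ hτ m
    have hs := hnorm τ hτ
    have hs' : ∀ m : ℤ, Summable fun n => (a m n - b m n) * e τ ^ n := fun m =>
      hs.of_norm.prod_factor m
    have h0 := eq_zero_of_hasSum_exp (φ := id) Function.injective_id
      (c := fun m : ℤ => ∑' n, (a m n - b m n) * e τ ^ n) ?_ (fun t ht ht0 => ?_) m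
    · rw [← h0]; exact (hs' m).hasSum
    · refine Summable.of_nonneg_of_le (fun _ => norm_nonneg _) (fun m => ?_) hs.prod
      exact norm_tsum_le_tsum_norm (hs.prod_factor m)
    · refine (hsum τ hτ t ht ht0).prod_fiberwise fun m => ?_
      refine ((hs' m).hasSum.mul_right _).congr_fun fun n => ?_
      rw [← Complex.exp_int_mul]
      simp only [id, mul_assoc]
      ring
  -- Orthogonality in `q` on the circle `|q| = e^(-2π)`, where `τ = i + t / 2π`.
  funext m n
  have h0 := eq_zero_of_hasSum_exp (φ := fun n : ℕ => (n : ℤ)) Nat.cast_injective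
    (c := fun n : ℕ => (a m n - b m n) * e Complex.I ^ n)
    ((hnorm Complex.I (by simp)).prod_factor m) (fun t ht ht0 => ?_) n
  · exact sub_eq_zero.mp ((mul_eq_zero.mp h0).resolve_right (pow_ne_zero _ (e_ne_zero _)))
  · have hpi := Complex.ofReal_ne_zero.mpr Real.pi_ne_zero
    refine (hrow (Complex.I + t / (2 * Real.pi)) (by
      rw [show (Complex.I + t / (2 * Real.pi) : ℂ) = Complex.I + ((t / (2 * Real.pi) : ℝ) : ℂ) by
        push_cast; rfl]
      rw [Complex.add_im, Complex.ofReal_im]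
      simp) m).congr_fun fun n => ?_
    rw [e_add, show e (t / (2 * Real.pi)) = Complex.exp (t * Complex.I) by
      rw [e]; congr 1; field_simp, mul_pow, ← Complex.exp_nat_mul]
    push_cast
    ring_nf

/-- The coefficient integral over `z = x + i y`, `|y| ≤ π`, with `q = e^(-z)`. -/
lemma two_pi_mul_coeff (k : ℕ) (m : ℤ) (n : ℕ) {x : ℝ} (hx : 0 < x) :
    2 * Real.pi * coeff k m n = ∫ y in -Real.pi..Real.pi,
      genFun k m (Complex.exp (-(x + y * Complex.I))) * Complex.exp (n * (x + y * Complex.I)) := by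
  have hn : ∀ y : ℝ, ‖Complex.exp (-(x + y * Complex.I))‖ = Real.exp (-x) := fun y => by
    rw [Complex.norm_exp]; simp
  have hlt : Real.exp (-x) < 1 := by rw [Real.exp_lt_one_iff]; linarith
  have h0 := integral_mul_exp_of_hasSum (φ := fun n : ℕ => -(n : ℤ))
    (fun a b h => by simpa using h) (c := fun n => coeff k m n * Complex.exp (-x) ^ n)
    (hasSum_coeff k m (q := Complex.exp (-x)) (by simpa using (hn 0).trans_lt hlt)).summable.norm
    (F := fun y => genFun k m (Complex.exp (-(x + y * Complex.I))))
    (fun t _ _ => (hasSum_coeff k m ((hn t).trans_lt hlt)).congr_fun fun n => by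
      rw [neg_add, Complex.exp_add, mul_pow, ← Complex.exp_nat_mul (-(t * Complex.I))]
      push_cast
      ring_nf) n
  have h1 : Complex.exp (-x) ^ n * Complex.exp (n * x) = 1 := by
    rw [← Complex.exp_nat_mul, ← Complex.exp_add]; simp
  calc _ = 2 * Real.pi * (coeff k m n * Complex.exp (-x) ^ n) * Complex.exp (n * x) := by
        linear_combination (-2 * Real.pi * coeff k m n) * h1
    _ = _ := by
        rw [← h0, ← intervalIntegral.integral_mul_const]
        refine intervalIntegral.integral_congr fun y _ => ?_
        rw [mul_assoc, ← Complex.exp_add]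
        congr 2
        push_cast
        ring

/-! ### Asymptotic power expansions in sectors -/

/-- The right half-line is contained in every sector of nonnegative aperture. -/
lemma neBot_nhdsWithin_sector {C : ℝ} (hC : 0 ≤ C) : (𝓝[sector C] (0 : ℂ)).NeBot := by
  rw [← mem_closure_iff_nhdsWithin_neBot]
  have h : Tendsto (fun n : ℕ => ((1 / ((n : ℝ) + 1) : ℝ) : ℂ)) atTop (𝓝 ((0 : ℝ) : ℂ)) :=
    (Complex.continuous_ofReal.tendsto 0).comp tendsto_one_div_add_atTop_nhds_zero_nat
  rw [Complex.ofReal_zero] at h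
  refine mem_closure_of_tendsto h (Eventually.of_forall fun n => ?_)
  simp only [sector, Set.mem_ofPred_eq, Complex.ofReal_re, Complex.ofReal_im, abs_zero]
  constructor <;> positivity

lemma ne_zero_of_mem_sector {C : ℝ} {z : ℂ} (hz : z ∈ sector C) : z ≠ 0 := by
  rintro rfl
  exact lt_irrefl _ hz.1

lemma isBigO_pow_of_le {C : ℝ} {M N : ℕ} (h : M ≤ N) :
    (fun z : ℂ => z ^ N) =O[𝓝[sector C] 0] fun z => z ^ M := by
  have h1 := (isBigO_refl (fun z : ℂ => z ^ M) (𝓝[sector C] 0)).mul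
    (((continuous_pow (N - M)).tendsto (0 : ℂ)).isBigO_one ℂ |>.mono nhdsWithin_le_nhds)
  simpa [← pow_add, h] using h1

/-- Coefficients of an asymptotic power expansion are unique. -/
lemma eq_zero_of_sum_isBigO {M : ℕ} {b : ℕ → ℂ}
    (hb : (fun z : ℂ => ∑ i ∈ Finset.range M, b i * z ^ i) =O[𝓝[sector 0] 0] fun z => z ^ M) :
    ∀ i < M, b i = 0 := by
  have := neBot_nhdsWithin_sector le_rfl
  intro i
  induction i using Nat.strong_induction_on with
  | _ i ih =>
    intro hi
    have h1 : (fun z : ℂ => b i * z ^ i) =O[𝓝[sector 0] 0] fun z => z ^ (i + 1) := by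
      have h2 : (fun z : ℂ => ∑ j ∈ Finset.Ico (i + 1) M, b j * z ^ j)
          =O[𝓝[sector 0] 0] fun z => z ^ (i + 1) :=
        IsBigO.fun_sum fun j hj =>
          (isBigO_pow_of_le (Finset.mem_Ico.mp hj).1).const_mul_left (b j)
      refine ((hb.trans (isBigO_pow_of_le hi)).sub h2).congr_left fun z => ?_
      rw [← Finset.sum_range_add_sum_Ico _ (Nat.succ_le_of_lt hi), Finset.sum_range_succ,
        Finset.sum_eq_zero fun j hj => ?_]
      · simp
      · rw [ih j (Finset.mem_range.mp hj) ((Finset.mem_range.mp hj).trans hi), zero_mul]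
    have h3 : (fun _ : ℂ => b i) =O[𝓝[sector 0] 0] fun z => z := by
      have h4 := h1.mul (isBigO_refl (fun z : ℂ => (z ^ i)⁻¹) (𝓝[sector 0] 0))
      refine h4.congr' ?_ ?_
      · filter_upwards [self_mem_nhdsWithin] with z hz
        exact mul_inv_cancel_right₀ (pow_ne_zero i (ne_zero_of_mem_sector hz)) _
      · filter_upwards [self_mem_nhdsWithin] with z hz
        rw [pow_succ', mul_inv_cancel_right₀ (pow_ne_zero i (ne_zero_of_mem_sector hz))]
    have h5 : Tendsto (fun _ : ℂ => b i) (𝓝[sector 0] 0) (𝓝 0) :=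
      h3.trans_tendsto (tendsto_id.mono_left nhdsWithin_le_nhds)
    exact tendsto_nhds_unique tendsto_const_nhds h5

lemma exists_coeff_of_analyticAt {G : ℂ → ℂ} (hG : AnalyticAt ℂ G 0) (M : ℕ) :
    ∃ c : ℕ → ℂ, c 0 = G 0 ∧
      (fun z => G z - ∑ i ∈ Finset.range M, c i * z ^ i) =O[𝓝 0] fun z => z ^ M := by
  obtain ⟨p, hp⟩ := hG
  refine ⟨p.coeff, ?_, ?_⟩
  · exact hp.coeff_zero 1
  · have h := hp.isBigO_sub_partialSum_pow M
    simp only [zero_add, FormalMultilinearSeries.partialSum,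
      FormalMultilinearSeries.apply_eq_pow_smul_coeff, smul_eq_mul] at h
    refine (h.congr_left fun z => by
      congr 1
      exact Finset.sum_congr rfl fun i _ => mul_comm _ _).trans ?_
    exact IsBigO.of_bound 1 (Eventually.of_forall fun z => by simp)

/-- A function that, to every order, agrees with some analytic function up to that order in every
sector has an asymptotic power expansion. -/
lemma exists_expansion {F : ℂ → ℂ} (hF : ∀ M : ℕ, ∃ G : ℂ → ℂ, AnalyticAt ℂ G 0 ∧ G 0 = 0 ∧
      ∀ C : ℝ, (fun z => F z - G z) =O[𝓝[sector C] 0] fun z => z ^ M) :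
    ∃ d : ℕ → ℂ, d 0 = 0 ∧ ∀ (M : ℕ) (C : ℝ),
      (fun z => F z - ∑ i ∈ Finset.range M, d i * z ^ i) =O[𝓝[sector C] 0] fun z => z ^ M := by
  have h1 : ∀ M : ℕ, ∃ c : ℕ → ℂ, c 0 = 0 ∧ ∀ C : ℝ,
      (fun z => F z - ∑ i ∈ Finset.range M, c i * z ^ i) =O[𝓝[sector C] 0] fun z => z ^ M := by
    intro M
    obtain ⟨G, hG, hG0, hFG⟩ := hF M
    obtain ⟨c, hc0, hc⟩ := exists_coeff_of_analyticAt hG M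
    refine ⟨c, hc0.trans hG0, fun C => ?_⟩
    refine ((hFG C).add (hc.mono nhdsWithin_le_nhds)).congr_left fun z => by ring
  choose c hc0 hc using h1
  -- The expansions to different orders have the same coefficients.
  have hcons : ∀ i M, i < M → c M i = c (i + 1) i := by
    intro i M hi
    have h2 : (fun z : ℂ => ∑ j ∈ Finset.Ico (i + 1) M, c M j * z ^ j)
        =O[𝓝[sector 0] 0] fun z => z ^ (i + 1) :=
      IsBigO.fun_sum fun j hj => (isBigO_pow_of_le (Finset.mem_Ico.mp hj).1).const_mul_left (c M j)
    have h3 := ((hc (i + 1) 0).sub ((hc M 0).trans (isBigO_pow_of_le hi))).sub h2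
    refine sub_eq_zero.mp (eq_zero_of_sum_isBigO (M := i + 1) (b := fun j => c M j - c (i + 1) j)
      (h3.congr_left fun z => ?_) i (Nat.lt_succ_self i))
    rw [← Finset.sum_range_add_sum_Ico _ (Nat.succ_le_of_lt hi)]
    simp only [sub_mul, Finset.sum_sub_distrib]
    ring
  refine ⟨fun i => c (i + 1) i, hc0 1, fun M C => (hc M C).congr_left fun z => ?_⟩
  rw [Finset.sum_congr rfl fun i hi => by rw [hcons i M (Finset.mem_range.mp hi)]]

lemma sum_Icc_eq_sum_range {d : ℕ → ℂ} (h0 : d 0 = 0) (N : ℕ) (z : ℂ) :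
    ∑ ℓ ∈ Finset.Icc 1 N, d ℓ * z ^ ℓ = ∑ i ∈ Finset.range (N + 1), d i * z ^ i := by
  rw [Finset.range_eq_Ico, Finset.sum_eq_sum_Ico_succ_bot (Nat.succ_pos N)]
  simp only [h0, zero_mul, zero_add]
  rfl

lemma IsTaylorCoeff.unique {m : ℤ} {k : ℕ} {d d' : ℕ → ℂ} (h : IsTaylorCoeff m k d)
    (h' : IsTaylorCoeff m k d') : d = d' := by
  funext i
  have h1 := (h'.2 (i + 1) (by omega) 0).sub (h.2 (i + 1) (by omega) 0)
  refine sub_eq_zero.mp (eq_zero_of_sum_isBigO (M := i + 2) (b := fun j => d j - d' j)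
      (h1.congr_left fun z => ?_) i (by omega))
  rw [sum_Icc_eq_sum_range h.1, sum_Icc_eq_sum_range h'.1]
  simp only [sub_mul, Finset.sum_sub_distrib]
  ring

/-! ### Euler's transformation of alternating series -/

/-- The negative of the forward difference, `(diffOp f)(w) = f(w) - f(w + 1)`. -/
def diffOp (f : ℂ → ℂ) (w : ℂ) : ℂ := f w - f (w + 1)

lemma summable_diffOp {f : ℂ → ℂ} (hf : Summable fun n : ℕ => (-1) ^ n * f n) :
    Summable fun n : ℕ => (-1) ^ n * diffOp f n := by
  have h1 := ((summable_nat_add_iff 1).mpr hf)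
  refine (hf.add h1).congr fun n => ?_
  simp only [diffOp]
  push_cast
  ring

lemma tsum_alternating_eq {f : ℂ → ℂ} (hf : Summable fun n : ℕ => (-1) ^ n * f n) :
    ∑' n : ℕ, (-1) ^ n * f n = 2⁻¹ * f 0 + 2⁻¹ * ∑' n : ℕ, (-1) ^ n * diffOp f n := by
  have h1 := ((summable_nat_add_iff 1).mpr hf)
  have h2 : ∑' n : ℕ, (-1) ^ n * diffOp f n
      = ∑' n : ℕ, (-1) ^ n * f n + ∑' n : ℕ, (-1) ^ (n + 1) * f (n + 1 : ℕ) := by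
    rw [← hf.tsum_add h1]
    refine tsum_congr fun n => ?_
    simp only [diffOp]
    push_cast
    ring
  have h3 := hf.tsum_eq_zero_add
  simp only [pow_zero, Nat.cast_zero, one_mul] at h3
  rw [h2]
  linear_combination 2⁻¹ * h3

/-- Euler's transformation of an alternating series, with remainder. -/
lemma tsum_alternating_eq_sum_diffOp (J : ℕ) {f : ℂ → ℂ}
    (hf : Summable fun n : ℕ => (-1) ^ n * f n) :
    ∑' n : ℕ, (-1) ^ n * f n = ∑ j ∈ Finset.range J, 2⁻¹ ^ (j + 1) * diffOp^[j] f 0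
      + 2⁻¹ ^ J * ∑' n : ℕ, (-1) ^ n * diffOp^[J] f n := by
  have hs : ∀ j, Summable fun n : ℕ => (-1) ^ n * diffOp^[j] f n := fun j => by
    induction j with
    | zero => exact hf
    | succ j ih => rw [Function.iterate_succ_apply']; exact summable_diffOp ih
  induction J with
  | zero => simp
  | succ J ih =>
    rw [ih, tsum_alternating_eq (hs J), Finset.sum_range_succ, Function.iterate_succ_apply']
    ring

lemma differentiable_diffOp {f : ℂ → ℂ} (hf : Differentiable ℂ f) :
    Differentiable ℂ (diffOp f) := by
  unfold diffOp; fun_prop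

/-- By Cauchy's estimate for `f'` on circles of radius `δ`. -/
lemma norm_diffOp_le {f : ℂ → ℂ} (hf : Differentiable ℂ f) {c : ℂ} {ρ δ M : ℝ} (hδ : 0 < δ)
    (hM : ∀ w, ‖w - c‖ ≤ ρ + (1 + δ) → ‖f w‖ ≤ M) {w : ℂ} (hw : ‖w - c‖ ≤ ρ) :
    ‖diffOp f w‖ ≤ M / δ := by
  have hd : ∀ v ∈ Metric.closedBall w 1, ‖deriv f v‖ ≤ M / δ := by
    intro v hv
    refine Complex.norm_deriv_le_of_forall_mem_sphere_norm_le hδ hf.diffContOnCl fun u hu => ?_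
    rw [mem_sphere_iff_norm] at hu
    rw [mem_closedBall_iff_norm] at hv
    refine hM u ?_
    calc ‖u - c‖ = ‖(u - v) + (v - w) + (w - c)‖ := by congr 1; ring
      _ ≤ ‖u - v‖ + ‖v - w‖ + ‖w - c‖ := norm_add₃_le
      _ ≤ _ := by linarith
  have h := (convex_closedBall w 1).norm_image_sub_le_of_norm_deriv_le (f := f) (x := w + 1)
    (y := w) (fun v _ => hf v) hd (by simp) (by simp)
  simpa [diffOp] using h

lemma norm_iterate_diffOp_le (J : ℕ) : ∀ {f : ℂ → ℂ}, Differentiable ℂ f → ∀ {c : ℂ} {ρ δ M : ℝ},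
    0 < δ → (∀ w, ‖w - c‖ ≤ ρ + J * (1 + δ) → ‖f w‖ ≤ M) → ∀ {w : ℂ}, ‖w - c‖ ≤ ρ →
    ‖diffOp^[J] f w‖ ≤ M / δ ^ J := by
  induction J with
  | zero =>
    intro f _ c ρ δ M _ hM w hw
    simpa using hM w (by simpa using hw)
  | succ J ih =>
    intro f hf c ρ δ M hδ hM w hw
    rw [Function.iterate_succ_apply, pow_succ', ← div_div]
    refine ih (differentiable_diffOp hf) hδ (fun v hv => norm_diffOp_le hf hδ (ρ := ρ + J * (1 + δ)) ?_ hv) hw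
    intro u hu
    refine hM u (hu.trans (le_of_eq ?_))
    push_cast
    ring

/-! ### Taylor expansion of the false theta function -/

/-- The entire function of `w` that interpolates `n ↦ q^(n(n+1)/2 + n r)`, where `q = e^(-z)`. -/
def gaussTerm (r : ℕ) (z w : ℂ) : ℂ := Complex.exp (-(z * (w * (w + 1) / 2 + w * r)))

lemma gaussTerm_natCast (r : ℕ) (z : ℂ) (n : ℕ) :
    gaussTerm r z n = Complex.exp (-z) ^ (n * (n + 1) / 2 + n * r) := by
  rw [gaussTerm, ← Complex.exp_nat_mul]
  congr 1
  have h : ((n * (n + 1) / 2 : ℕ) : ℂ) = n * (n + 1) / 2 := by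
    rw [Nat.cast_div (Nat.even_mul_succ_self n).two_dvd (by norm_num)]
    push_cast
    ring
  rw [Nat.cast_add, h]
  push_cast
  ring

lemma partialTheta_exp_neg (r : ℕ) (z : ℂ) :
    partialTheta r (Complex.exp (-z)) = ∑' n : ℕ, (-1) ^ n * gaussTerm r z n := by
  simp_rw [partialTheta, gaussTerm_natCast]

lemma norm_exp_neg_lt_one {z : ℂ} (hz : 0 < z.re) : ‖Complex.exp (-z)‖ < 1 := by
  rw [Complex.norm_exp, Complex.neg_re, Real.exp_lt_one_iff]
  linarith

lemma norm_le_of_mem_sector {C : ℝ} {z : ℂ} (hz : z ∈ sector C) : ‖z‖ ≤ (1 + C) * z.re := by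
  have := Complex.norm_le_abs_re_add_abs_im z
  rw [abs_of_pos hz.1] at this
  linarith [hz.2]

lemma one_add_pos_of_mem_sector {C : ℝ} {z : ℂ} (hz : z ∈ sector C) : 0 < 1 + C := by
  have h1 := hz.1
  have h2 := (abs_nonneg _).trans hz.2
  nlinarith

/-- Within distance `O(|z|^(-1/2))` of the integer `n`, the Gaussian is bounded in terms of
`|z|^(1/2) n` alone, uniformly in the sector. -/
lemma exists_norm_gaussTerm_le (r : ℕ) (C B : ℝ) :
    ∃ K, 0 ≤ K ∧ ∀ z ∈ sector C, ‖z‖ ≤ 1 → ∀ (n : ℕ) (w : ℂ), ‖w - n‖ * √‖z‖ ≤ B →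
      ‖gaussTerm r z w‖ ≤ K * Real.exp (-√‖z‖ * n) := by
  refine ⟨Real.exp ((B + 1) ^ 2 * (1 + |C|) / 2 + B ^ 2 / 2 + (r + 1 / 2) * B),
    (Real.exp_pos _).le, fun z hz hz1 n w hw => ?_⟩
  rw [gaussTerm, Complex.norm_exp, ← Real.exp_add, Real.exp_le_exp]
  set s := √‖z‖ with hs
  have hs0 : 0 ≤ s := Real.sqrt_nonneg _
  have hs2 : s ^ 2 = ‖z‖ := Real.sq_sqrt (norm_nonneg _)
  have hs1 : s ≤ 1 := Real.sqrt_le_one.mpr hz1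
  set v := w - n with hv
  have hw' : w = n + v := by rw [hv]; ring
  have hsplit : -(z * (w * (w + 1) / 2 + w * r))
      = -((((n : ℝ) * (n + 1) / 2 + n * r : ℝ) : ℂ) * z) - z * (n * v + v ^ 2 / 2 + (r + 1 / 2) * v) := by
    rw [hw']; push_cast; ring
  have hn0 : (0 : ℝ) ≤ n := Nat.cast_nonneg n
  have hr0 : (0 : ℝ) ≤ r := Nat.cast_nonneg r
  have h1 : (-(z * (n * v + v ^ 2 / 2 + (r + 1 / 2) * v))).re
      ≤ s * n * B + B ^ 2 / 2 + (r + 1 / 2) * B := by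
    refine (Complex.re_le_norm _).trans ?_
    rw [norm_neg, norm_mul]
    have hb : ‖(n * v + v ^ 2 / 2 + (r + 1 / 2) * v : ℂ)‖
        ≤ n * ‖v‖ + ‖v‖ ^ 2 / 2 + (r + 1 / 2) * ‖v‖ := by
      refine norm_add₃_le.trans ?_
      have : ‖((r : ℂ) + 1 / 2)‖ = r + 1 / 2 := by
        rw [show ((r : ℂ) + 1 / 2) = ((r + 1 / 2 : ℝ) : ℂ) by push_cast; ring, Complex.norm_real,
          Real.norm_of_nonneg (by positivity)]
      rw [norm_mul, norm_mul, norm_div, norm_pow, this, Complex.norm_natCast]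
      simp
    have hv0 := norm_nonneg v
    calc ‖z‖ * _ ≤ s ^ 2 * (n * ‖v‖ + ‖v‖ ^ 2 / 2 + (r + 1 / 2) * ‖v‖) := by
          rw [hs2]; gcongr
      _ = s * n * (‖v‖ * s) + (‖v‖ * s) ^ 2 / 2 + (r + 1 / 2) * (s * (‖v‖ * s)) := by ring
      _ ≤ s * n * B + B ^ 2 / 2 + (r + 1 / 2) * (1 * B) := by gcongr
      _ = _ := by ring
  have hC := one_add_pos_of_mem_sector hz
  have hCa : 1 + C ≤ 1 + |C| := by linarith [le_abs_self C]
  have hz2 : s ^ 2 ≤ (1 + |C|) * z.re := by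
    rw [hs2]
    exact (norm_le_of_mem_sector hz).trans (mul_le_mul_of_nonneg_right hCa hz.1.le)
  have h2 : ((n : ℝ) ^ 2 / 2) * z.re ≤ ((n : ℝ) * (n + 1) / 2 + n * r) * z.re := by
    apply mul_le_mul_of_nonneg_right _ hz.1.le
    nlinarith [mul_nonneg hn0 hr0]
  rw [hsplit, sub_eq_add_neg, Complex.add_re, Complex.neg_re, Complex.re_ofReal_mul]
  set A := 1 + |C| with hA
  have hA0 : 0 < A := by positivity
  -- Completing the square in `s n` absorbs the linear term `s n B`, and a further `s n`.
  have h3 : s * n * (B + 1) ≤ ((n : ℝ) ^ 2 / 2) * z.re + (B + 1) ^ 2 * A / 2 := by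
    have h4 : 0 ≤ (s * n - (B + 1) * A) ^ 2 / (2 * A) := by positivity
    have h5 : (s * n - (B + 1) * A) ^ 2 / (2 * A)
        = s ^ 2 * n ^ 2 / (2 * A) - s * n * (B + 1) + (B + 1) ^ 2 * A / 2 := by
      field_simp; ring
    have h6 : s ^ 2 * n ^ 2 / (2 * A) ≤ ((n : ℝ) ^ 2 / 2) * z.re := by
      rw [div_le_iff₀ (by positivity)]
      nlinarith [mul_le_mul_of_nonneg_right hz2 (sq_nonneg (n : ℝ))]
    linarith
  linarith

lemma differentiable_gaussTerm (r : ℕ) (z : ℂ) : Differentiable ℂ (gaussTerm r z) := by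
  unfold gaussTerm; fun_prop

lemma differentiable_iterate_diffOp_gaussTerm (r j : ℕ) (w : ℂ) :
    Differentiable ℂ fun z => diffOp^[j] (gaussTerm r z) w := by
  induction j generalizing w with
  | zero => simp only [Function.iterate_zero, id, gaussTerm]; fun_prop
  | succ j ih =>
    simp only [Function.iterate_succ_apply', diffOp]
    exact (ih w).sub (ih (w + 1))

lemma iterate_diffOp_gaussTerm_zero (r j : ℕ) (w : ℂ) :
    diffOp^[j + 1] (gaussTerm r 0) w = 0 := by
  induction j generalizing w with
  | zero => simp [diffOp, gaussTerm]
  | succ j ih => rw [Function.iterate_succ_apply', diffOp, ih, ih, sub_zero]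

lemma summable_alternating_gaussTerm (r : ℕ) {z : ℂ} (hz : 0 < z.re) :
    Summable fun n : ℕ => (-1) ^ n * gaussTerm r z n := by
  simp_rw [gaussTerm_natCast]
  exact summable_partialTheta (norm_exp_neg_lt_one hz) r

lemma hasSum_exp_neg_mul_and_le {s : ℝ} (hs0 : 0 < s) (hs1 : s ≤ 1) :
    HasSum (fun n : ℕ => Real.exp (-s * n)) (1 - Real.exp (-s))⁻¹ ∧
      (1 - Real.exp (-s))⁻¹ ≤ 2 / s := by
  constructor
  · have := hasSum_geometric_of_lt_one (Real.exp_pos (-s)).le (Real.exp_lt_one_iff.mpr (by linarith : -s < 0))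
    refine this.congr_fun fun n => ?_
    rw [← Real.exp_nat_mul, mul_comm]
  · have h1 : Real.exp (-s) ≤ 1 / (1 + s) := by
      rw [Real.exp_neg, ← one_div]
      gcongr
      linarith [Real.add_one_le_exp s]
    have h2 : s / 2 ≤ 1 - Real.exp (-s) := by
      have : 1 / (1 + s) = 1 - s / (1 + s) := by field_simp; ring
      have : s / 2 ≤ s / (1 + s) := by gcongr; linarith
      linarith
    calc (1 - Real.exp (-s))⁻¹ ≤ (s / 2)⁻¹ := by gcongr
      _ = 2 / s := by rw [inv_div]

/-- Euler's transformation turns the partial theta function into an entire function of `z`, up to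
an error of high order. -/
lemma exists_partialTheta_approx (r N : ℕ) : ∃ G : ℂ → ℂ, Differentiable ℂ G ∧ G 0 = 2⁻¹ ∧
    ∀ C : ℝ, (fun z => partialTheta r (Complex.exp (-z)) - G z)
      =O[𝓝[sector C] 0] fun z => z ^ N := by
  -- Each difference gains `|z|^(1/2)`, and the summation over `n` costs one such factor.
  set J := 2 * N + 1 with hJ
  refine ⟨fun z => ∑ j ∈ Finset.range J, 2⁻¹ ^ (j + 1) * diffOp^[j] (gaussTerm r z) 0, ?_, ?_,
    fun C => ?_⟩
  · exact Differentiable.fun_sum fun j _ =>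
      (differentiable_iterate_diffOp_gaussTerm r j 0).const_mul _
  · beta_reduce
    rw [hJ, Finset.sum_range_succ', Finset.sum_eq_zero fun j _ => by
      rw [iterate_diffOp_gaussTerm_zero, mul_zero]]
    simp [gaussTerm]
  · obtain ⟨K, hK0, hK⟩ := exists_norm_gaussTerm_le r C (2 * J)
    refine IsBigO.of_bound (2 * K) ?_
    have hball : ∀ᶠ z : ℂ in 𝓝[sector C] 0, ‖z‖ ≤ 1 := by
      filter_upwards [nhdsWithin_le_nhds (Metric.closedBall_mem_nhds (0 : ℂ) one_pos)] with z hz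
      simpa using hz
    filter_upwards [self_mem_nhdsWithin, hball] with z hz hz1
    set s := √‖z‖ with hs
    have hz0 : 0 < ‖z‖ := norm_pos_iff.mpr (ne_zero_of_mem_sector hz)
    have hs0 : 0 < s := Real.sqrt_pos.mpr hz0
    have hs1 : s ≤ 1 := Real.sqrt_le_one.mpr hz1
    rw [partialTheta_exp_neg, tsum_alternating_eq_sum_diffOp J
      (summable_alternating_gaussTerm r hz.1), add_sub_cancel_left]
    have hterm : ∀ n : ℕ, ‖(-1) ^ n * diffOp^[J] (gaussTerm r z) n‖
        ≤ K * s ^ J * Real.exp (-s * n) := by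
      intro n
      rw [norm_mul, norm_pow, norm_neg, norm_one, one_pow, one_mul]
      refine (norm_iterate_diffOp_le J (differentiable_gaussTerm r z) (c := n) (ρ := 0)
        (inv_pos.mpr hs0) (M := K * Real.exp (-s * n)) (fun w hw => hK z hz hz1 n w ?_)
        (by simp)).trans (le_of_eq ?_)
      · calc ‖w - n‖ * s ≤ (0 + J * (1 + s⁻¹)) * s := by gcongr
          _ = J * (s + 1) := by field_simp; ring
          _ ≤ J * (1 + 1) := by gcongr
          _ = _ := by ring
      · rw [inv_pow, div_inv_eq_mul]; ring
    obtain ⟨hsum, hle⟩ := hasSum_exp_neg_mul_and_le hs0 hs1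
    have h1 := tsum_of_norm_bounded (hsum.mul_left (K * s ^ J)) hterm
    rw [norm_mul, norm_pow, norm_inv]
    calc _ ≤ 1 * (K * s ^ J * (2 / s)) := by
          gcongr
          · exact pow_le_one₀ (by positivity) (by norm_num)
          · exact h1.trans (by gcongr)
      _ = 2 * K * (s ^ 2) ^ N := by rw [hJ, pow_succ, pow_mul]; field_simp
      _ = _ := by rw [hs, Real.sq_sqrt hz0.le, norm_pow]

lemma exists_isTaylorCoeff (m : ℤ) (k : ℕ) : ∃ d, IsTaylorCoeff m k d := by
  obtain ⟨d, hd0, hd⟩ := exists_expansion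
    (F := fun z => Complex.exp (-(k * z / 24)) * falseTheta m (Complex.exp (-z))) fun M => by
    obtain ⟨G, hG, hG0, hGO⟩ := exists_partialTheta_approx m.natAbs M
    refine ⟨fun z => Complex.exp (-(k * z / 24)) *
      ((1 + Complex.exp (-z) ^ m.natAbs) * G z - 1), Differentiable.analyticAt (by fun_prop) 0,
      ?_, fun C => ?_⟩
    · simp [hG0]; norm_num
    · have hb : (fun z : ℂ => Complex.exp (-(k * z / 24)) * (1 + Complex.exp (-z) ^ m.natAbs))
          =O[𝓝[sector C] 0] fun _ => (1 : ℂ) :=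
        ((Continuous.tendsto (by fun_prop) 0).isBigO_one ℂ).mono nhdsWithin_le_nhds
      refine (hb.mul (hGO C)).congr (fun z => ?_) fun z => by rw [one_mul]
      rw [falseTheta_eq_partialTheta]
      ring
  refine ⟨d, hd0, fun N _ C => (hd (N + 1) C).congr_left fun z => ?_⟩
  rw [sum_Icc_eq_sum_range hd0]

/-! ### The eta transformation -/

/-- The nome `exp(-4 π² / z)` conjugate to `exp(-z)` under `τ ↦ -1/τ`. -/
def dualNome (z : ℂ) : ℂ := Complex.exp (-(4 * Real.pi ^ 2 / z))

lemma arg_mem_Ioo_of_re_pos {z : ℂ} (hz : 0 < z.re) :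
    -(Real.pi / 2) < z.arg ∧ z.arg < Real.pi / 2 :=
  abs_lt.mp (Complex.abs_arg_lt_pi_div_two_iff.mpr (Or.inl hz))

/-- The transformation law of the eta function, in terms of `q = e^(-z)`. -/
lemma inv_eulerProd_exp_neg {z : ℂ} (hz : 0 < z.re) :
    (eulerProd (Complex.exp (-z)))⁻¹ = Complex.exp ((Complex.log z - Real.log (2 * Real.pi)) / 2)
      * Complex.exp (-(z / 24)) * Complex.exp (Real.pi ^ 2 / (6 * z))
      * (eulerProd (dualNome z))⁻¹ := by
  have hz0 : z ≠ 0 := by rintro rfl; simp at hz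
  have hpi := Complex.ofReal_ne_zero.mpr Real.pi_ne_zero
  have h2pi : (0 : ℝ) < (2 * Real.pi)⁻¹ := by positivity
  set τ : ℂ := Complex.I * (((2 * Real.pi)⁻¹ : ℝ) * z) with hτ
  have hτ0 : τ ≠ 0 := by
    rw [hτ]
    exact mul_ne_zero Complex.I_ne_zero (mul_ne_zero (by exact_mod_cast h2pi.ne') hz0)
  have hτim : τ ∈ UpperHalfPlane.upperHalfPlaneSet := by
    show 0 < τ.im
    rw [hτ, Complex.I_mul_im, Complex.re_ofReal_mul]
    positivity
  have h := ModularForm.eta_comp_eq_csqrt_I_inv hτim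
  simp only [Function.comp, Pi.smul_apply, Pi.mul_apply, smul_eq_mul, eta_eq_e_mul_eulerProd] at h
  have hI : Complex.I ≠ 0 := Complex.I_ne_zero
  have hsqrt : Complex.sqrt τ
      = Complex.sqrt Complex.I * Complex.exp ((Complex.log z - Real.log (2 * Real.pi)) / 2) := by
    have hlog : Complex.log τ = Complex.log Complex.I + (Complex.log z - Real.log (2 * Real.pi)) := by
      obtain ⟨h1, h2⟩ := arg_mem_Ioo_of_re_pos hz
      have hp := Real.pi_pos
      rw [hτ, Complex.log_mul hI (mul_ne_zero (by exact_mod_cast h2pi.ne') hz0),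
        Complex.log_ofReal_mul h2pi hz0, Real.log_inv]
      · push_cast; ring
      · rw [Complex.arg_real_mul _ h2pi, Complex.arg_I]
        constructor <;> linarith
    simp only [Complex.sqrt]
    rw [Complex.cpow_def_of_ne_zero hτ0, Complex.cpow_def_of_ne_zero hI, hlog, ← Complex.exp_add]
    congr 1
    ring
  have e1 : e τ = Complex.exp (-z) := by
    rw [e, hτ]; congr 1; push_cast; field_simp; rw [Complex.I_sq]
  have e2 : e (τ / 24) = Complex.exp (-(z / 24)) := by
    rw [e, hτ]; congr 1; push_cast; field_simp; rw [Complex.I_sq]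
  have e3 : e (-1 / τ) = dualNome z := by
    rw [e, hτ, dualNome]; congr 1; push_cast; field_simp; ring
  have e4 : e (-1 / τ / 24) = Complex.exp (-(Real.pi ^ 2 / (6 * z))) := by
    rw [e, hτ]; congr 1; push_cast; field_simp; ring
  rw [e1, e2, e3, e4, hsqrt] at h
  have hsI : Complex.sqrt Complex.I ≠ 0 := by
    rw [Complex.sqrt, Complex.cpow_def_of_ne_zero hI]; exact Complex.exp_ne_zero _
  have hE1 := eulerProd_ne_zero (norm_exp_neg_lt_one hz)
  have hQ : ‖dualNome z‖ < 1 := by rw [← e3]; exact norm_e_lt_one (by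
    have := UpperHalfPlane.im_inv_neg_coe_pos ⟨τ, hτim⟩
    rw [neg_div, one_div]
    simpa [← inv_neg] using this)
  have hE2 := eulerProd_ne_zero hQ
  rw [Complex.exp_neg] at h
  field_simp at h ⊢
  linear_combination h

lemma norm_exp_inv {c : ℝ} (z : ℂ) : ‖Complex.exp (c / z)‖ = Real.exp (c * (z.re / ‖z‖ ^ 2)) := by
  rw [Complex.norm_exp, div_eq_mul_inv, Complex.re_ofReal_mul, Complex.inv_re, Complex.sq_norm]

lemma norm_dualNome (z : ℂ) : ‖dualNome z‖ = Real.exp (-(4 * Real.pi ^ 2) * (z.re / ‖z‖ ^ 2)) := by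
  rw [← norm_exp_inv, dualNome]
  congr 2
  push_cast
  ring

/-- The exponent `A = k π² / 6` in `(q; q)_∞^(-k) ≈ e^(A / z)`. -/
def growth (k : ℕ) : ℝ := k * Real.pi ^ 2 / 6

lemma growth_pos {k : ℕ} (hk : 1 ≤ k) : 0 < growth k := by
  have : (0 : ℝ) < k := by exact_mod_cast hk
  unfold growth; positivity

lemma inv_eulerProd_pow_exp_neg (k : ℕ) {z : ℂ} (hz : 0 < z.re) :
    (eulerProd (Complex.exp (-z)) ^ k)⁻¹ = (((2 * Real.pi) ^ (-(k : ℝ) / 2) : ℝ) : ℂ)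
      * z ^ (((k : ℝ) / 2 : ℝ) : ℂ) * Complex.exp (-(k * z / 24)) * Complex.exp (growth k / z)
      * (eulerProd (dualNome z) ^ k)⁻¹ := by
  have hz0 : z ≠ 0 := by rintro rfl; simp at hz
  rw [← inv_pow, inv_eulerProd_exp_neg hz, mul_pow, mul_pow, mul_pow, inv_pow,
    ← Complex.exp_nat_mul, ← Complex.exp_nat_mul, ← Complex.exp_nat_mul,
    Real.rpow_def_of_pos (by positivity), Complex.cpow_def_of_ne_zero hz0, Complex.ofReal_exp,
    ← Complex.exp_add _ (Complex.log z * _)]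
  have h1 : (k : ℂ) * ((Complex.log z - Real.log (2 * Real.pi)) / 2)
      = ((Real.log (2 * Real.pi) * (-(k : ℝ) / 2) : ℝ) : ℂ)
        + Complex.log z * (((k : ℝ) / 2 : ℝ) : ℂ) := by
    push_cast; ring
  have h2 : (k : ℂ) * (Real.pi ^ 2 / (6 * z)) = growth k / z := by
    rw [growth]; push_cast; field_simp
  have h3 : (k : ℂ) * -(z / 24) = -(k * z / 24) := by ring
  rw [h1, h2, h3]

/-- The bracket `(Q; Q)_∞^(-k) q^(k/24) ϑ_m(q)`, with `Q` the conjugate nome, is what remains of the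
generating function after splitting off `(2π)^(-k/2) z^(k/2) e^(A/z)`. -/
def bracket (k : ℕ) (m : ℤ) (z : ℂ) : ℂ := (eulerProd (dualNome z) ^ k)⁻¹
  * (Complex.exp (-(k * z / 24)) * falseTheta m (Complex.exp (-z)))

lemma genFun_exp_neg (k : ℕ) (m : ℤ) {z : ℂ} (hz : 0 < z.re) :
    genFun k m (Complex.exp (-z)) = (((2 * Real.pi) ^ (-(k : ℝ) / 2) : ℝ) : ℂ)
      * (z ^ (((k : ℝ) / 2 : ℝ) : ℂ) * Complex.exp (growth k / z) * bracket k m z) := by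
  rw [genFun, div_eq_mul_inv, inv_eulerProd_pow_exp_neg k hz, bracket]
  ring

/-- The conjugate nome is exponentially small in `1 / |z|` within a sector. -/
lemma dualNome_isBigO (C : ℝ) (M : ℕ) :
    dualNome =O[𝓝[sector C] 0] fun z => z ^ M := by
  refine IsBigO.of_bound (M.factorial * ((1 + C) / (4 * Real.pi ^ 2)) ^ M) ?_
  filter_upwards [self_mem_nhdsWithin] with z hz
  have hC := one_add_pos_of_mem_sector hz
  have hz0 : 0 < ‖z‖ := norm_pos_iff.mpr (ne_zero_of_mem_sector hz)
  have h1 := norm_le_of_mem_sector hz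
  have hx : 0 < (4 * Real.pi ^ 2) / ((1 + C) * ‖z‖) := by positivity
  have h2 : ‖dualNome z‖ ≤ Real.exp (-((4 * Real.pi ^ 2) / ((1 + C) * ‖z‖))) := by
    rw [norm_dualNome, Real.exp_le_exp, neg_mul, neg_le_neg_iff, div_eq_mul_inv]
    gcongr
    rw [inv_le_iff_one_le_mul₀ (by positivity)]
    rw [show z.re / ‖z‖ ^ 2 * ((1 + C) * ‖z‖) = (1 + C) * z.re / ‖z‖ by field_simp,
      le_div_iff₀ hz0]
    linarith
  refine h2.trans ?_
  have h3 := Real.pow_div_factorial_le_exp _ hx.le M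
  rw [Real.exp_neg, norm_pow]
  have h4 : 0 < ((4 * Real.pi ^ 2) / ((1 + C) * ‖z‖)) ^ M / M.factorial := by positivity
  refine (inv_anti₀ h4 h3).trans (le_of_eq ?_)
  rw [inv_div, div_pow, div_pow, mul_pow]
  field_simp
  rw [mul_pow]

lemma eulerProd_zero : eulerProd 0 = 1 := by simp [eulerProd]

/-- The factor `(Q; Q)_∞^(-k)` is `1` up to a flat error, so the bracket has the asymptotic expansion
of `q^(k/24) ϑ_m(q)`. -/
lemma bracket_isBigO {k : ℕ} {m : ℤ} {d : ℕ → ℂ} (hd : IsTaylorCoeff m k d) {N : ℕ} (hN : 1 ≤ N)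
    (C : ℝ) : (fun z => bracket k m z - ∑ ℓ ∈ Finset.Icc 1 N, d ℓ * z ^ ℓ)
      =O[𝓝[sector C] 0] fun z => z ^ (N + 1) := by
  have hE : DifferentiableAt ℂ (fun u => (eulerProd u ^ k)⁻¹) 0 := by
    refine DifferentiableAt.inv (DifferentiableAt.pow ?_ k) (by simp [eulerProd_zero])
    exact ModularForm.differentiableOn_tprod_one_sub_pow.differentiableAt
      (Metric.ball_mem_nhds 0 one_pos)
  have hQ0 : Tendsto dualNome (𝓝[sector C] 0) (𝓝 0) := by
    refine (dualNome_isBigO C 1).trans_tendsto ?_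
    simp only [pow_one]
    exact tendsto_id.mono_left nhdsWithin_le_nhds
  have h1 := hE.isBigO_sub.comp_tendsto hQ0
  simp only [Function.comp_def, eulerProd_zero, one_pow, inv_one, sub_zero] at h1
  have h2 := h1.trans (dualNome_isBigO C (N + 1))
  have hH := hd.2 N hN C
  have hone : (fun z : ℂ => z ^ (N + 1)) =O[𝓝[sector C] 0] fun _ => (1 : ℂ) :=
    ((continuous_pow (N + 1)).tendsto (0 : ℂ)).isBigO_one ℂ |>.mono nhdsWithin_le_nhds
  have hS : (fun z : ℂ => ∑ ℓ ∈ Finset.Icc 1 N, d ℓ * z ^ ℓ) =O[𝓝[sector C] 0] fun _ => (1 : ℂ) :=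
    (Continuous.tendsto (by fun_prop) (0 : ℂ)).isBigO_one ℂ |>.mono nhdsWithin_le_nhds
  have hB := (hH.trans hone).add hS
  have h3 := h2.mul hB
  simp only [mul_one] at h3
  refine (h3.add hH).congr_left fun z => ?_
  rw [bracket]
  ring

/-! ### Bounds for the Euler product away from `q = 1` -/

/-- `(1 - |w|) e^|w| ≤ |(1 - w) e^w|`: compare the logarithms, as power series. -/
lemma one_sub_norm_mul_exp_le {w : ℂ} (hw : ‖w‖ < 1) :
    (1 - ‖w‖) * Real.exp (‖w‖ - w.re) ≤ ‖1 - w‖ := by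
  have h1 := (hasSum_nat_add_iff' 2).mpr (Complex.hasSum_taylorSeries_neg_log hw)
  have h2 := (hasSum_nat_add_iff' 1).mpr
    (Real.hasSum_pow_div_log_of_abs_lt_one (x := ‖w‖) (by rwa [abs_norm]))
  simp only [Finset.sum_range_succ, Finset.sum_range_zero] at h1 h2
  norm_num at h1 h2
  have h3 := h1.norm_le_of_bounded h2 fun n => by
    rw [norm_div, norm_pow]
    refine le_of_eq ?_
    rw [show ((n : ℂ) + 2) = ((n + 2 : ℕ) : ℂ) by push_cast; rfl, Complex.norm_natCast]
    push_cast
    ring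
  have h4 := (Complex.re_le_norm _).trans h3
  rw [Complex.sub_re, Complex.neg_re, Complex.log_re] at h4
  have hne : 0 < ‖1 - w‖ := norm_pos_iff.mpr (one_sub_ne_zero_of_norm_lt_one hw)
  have hpos : 0 < 1 - ‖w‖ := by linarith
  rw [← Real.exp_log hpos, ← Real.exp_add]
  refine le_trans (Real.exp_le_exp.mpr ?_) (Real.exp_log hne).le
  linarith

/-- `one_sub_norm_mul_exp_le` for each power `w = q^n`, multiplied over `n ≥ 1`. -/
lemma norm_eulerProd_ge {q : ℂ} (hq : ‖q‖ < 1) :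
    ‖eulerProd (‖q‖ : ℂ)‖ * Real.exp (‖q‖ / (1 - ‖q‖) - (q / (1 - q)).re) ≤ ‖eulerProd q‖ := by
  have hq' : ‖(‖q‖ : ℂ)‖ < 1 := by simpa using hq
  have hA := (tendsto_qFact hq').norm
  have hB := (tendsto_qFact hq).norm
  have hs : ∀ {x : ℂ}, ‖x‖ < 1 → HasSum (fun n : ℕ => x ^ (n + 1)) (x / (1 - x)) := fun hx => by
    simpa [pow_succ', div_eq_mul_inv] using (hasSum_geometric_of_norm_lt_one hx).mul_left _
  have h1 := (Complex.hasSum_re (hs hq')).sub (Complex.hasSum_re (hs hq))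
  have h2 : ((‖q‖ : ℂ) / (1 - (‖q‖ : ℂ))).re = ‖q‖ / (1 - ‖q‖) := by
    rw [← Complex.ofReal_re (‖q‖ / (1 - ‖q‖))]; push_cast; rfl
  rw [h2] at h1
  have hC := (Real.continuous_exp.tendsto _).comp h1.tendsto_sum_nat
  refine le_of_tendsto_of_tendsto' (hA.mul hC) hB fun n => ?_
  simp only [Function.comp, qFact, norm_prod, Real.exp_sum, ← Finset.prod_mul_distrib]
  refine Finset.prod_le_prod (fun i _ => by positivity) fun i _ => ?_
  have h := one_sub_norm_mul_exp_le (norm_pow_succ_lt_one hq i)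
  have h3 : ‖(1 - (‖q‖ : ℂ) ^ (i + 1))‖ = 1 - ‖q ^ (i + 1)‖ := by
    rw [← Complex.ofReal_pow, ← Complex.ofReal_one, ← Complex.ofReal_sub, Complex.norm_real,
      Real.norm_of_nonneg, norm_pow]
    rw [← norm_pow]; linarith [norm_pow_succ_lt_one hq i]
  have h4 : ((‖q‖ : ℂ) ^ (i + 1)).re = ‖q ^ (i + 1)‖ := by
    rw [← Complex.ofReal_pow, Complex.ofReal_re, norm_pow]
  rw [h3, h4]
  exact h

/-- For `z = x + i y` with `|y|` large compared to `x`, the product `(q; q)_∞^(-1)` is smaller than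
at `|q|` by a factor exponentially small in `1 / x`. -/
lemma norm_inv_eulerProd_le_minor {x y : ℝ} (hx : 0 < x) (hx1 : x ≤ 1)
    (hxy : 2 * Real.pi * x ≤ |y|) (hy : |y| ≤ Real.pi) :
    ‖(eulerProd (Complex.exp (-(x + y * Complex.I))))⁻¹‖
      ≤ ‖(eulerProd (Complex.exp (-x)))⁻¹‖ * Real.exp (-(1 / (2 * x))) := by
  set q := Complex.exp (-(x + y * Complex.I)) with hq
  set ρ := Real.exp (-x) with hρ
  have hqn : ‖q‖ = ρ := by rw [hq, hρ, Complex.norm_exp]; simp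
  have hρ0 : 0 < ρ := Real.exp_pos _
  have hρ1 : ρ < 1 := by rw [hρ, Real.exp_lt_one_iff]; linarith
  have hρx : 1 - ρ ≤ x := by linarith [Real.add_one_le_exp (-x)]
  have hρ4 : 1 / 4 ≤ ρ := by
    have h1 : Real.exp (-1) ≤ ρ := Real.exp_le_exp.mpr (by linarith)
    have h2 := Real.exp_neg_one_gt_d9
    linarith
  have hq1 : ‖q‖ < 1 := hqn ▸ hρ1
  have hqc : (Complex.exp (-x) : ℂ) = (‖q‖ : ℂ) := by rw [hqn, hρ]; push_cast; rfl
  -- This is where the aperture `2π` enters: `1 - cos y ≥ 2 y² / π² ≥ 8 x²`.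
  have hlow : 2 * x ≤ ‖1 - q‖ := by
    refine le_of_sq_le_sq ?_ (norm_nonneg _)
    have hre : q.re = ρ * Real.cos y := by
      rw [hq, Complex.exp_re]; simp [hρ]
    have him : q.im = -(ρ * Real.sin y) := by
      rw [hq, Complex.exp_im]; simp [hρ]
    have hsq : ‖1 - q‖ ^ 2 = (1 - ρ) ^ 2 + 2 * ρ * (1 - Real.cos y) := by
      rw [Complex.sq_norm, Complex.normSq_apply]
      simp only [Complex.sub_re, Complex.one_re, Complex.sub_im, Complex.one_im, hre, him]
      have := Real.sin_sq_add_cos_sq y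
      linear_combination ρ ^ 2 * this
    have hcos := Real.cos_le_one_sub_mul_cos_sq hy
    have hy2 : 8 * x ^ 2 ≤ 2 / Real.pi ^ 2 * y ^ 2 := by
      have : (2 * Real.pi * x) ^ 2 ≤ y ^ 2 := by
        rw [← sq_abs y]; exact pow_le_pow_left₀ (by positivity) hxy 2
      rw [div_mul_eq_mul_div, le_div_iff₀ (by positivity)]
      nlinarith
    rw [hsq]
    nlinarith [sq_nonneg (1 - ρ), sq_nonneg x,
      mul_le_mul hρ4 (show 8 * x ^ 2 ≤ 1 - Real.cos y by linarith) (by positivity) hρ0.le]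
  have hne := one_sub_ne_zero_of_norm_lt_one hq1
  have hre : (q / (1 - q)).re ≤ 1 / (2 * x) - 1 := by
    have h1 : q / (1 - q) = (1 - q)⁻¹ - 1 := by field_simp; ring
    rw [h1, Complex.sub_re, Complex.one_re]
    have h2 := Complex.re_le_norm (1 - q)⁻¹
    rw [norm_inv] at h2
    have h3 : ‖1 - q‖⁻¹ ≤ 1 / (2 * x) := by
      rw [one_div]; exact inv_anti₀ (by positivity) hlow
    linarith
  have hrho : 1 / x - 1 ≤ ρ / (1 - ρ) := by
    have h1 : ρ / (1 - ρ) = 1 / (1 - ρ) - 1 := by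
      have : 1 - ρ ≠ 0 := by linarith
      field_simp
      ring
    rw [h1]
    gcongr
  have h := norm_eulerProd_ge hq1
  have hE := norm_pos_iff.mpr (eulerProd_ne_zero hq1)
  have hE' := norm_pos_iff.mpr (eulerProd_ne_zero (q := (‖q‖ : ℂ)) (by simpa using hq1))
  rw [hqc, norm_inv, norm_inv, Real.exp_neg, ← mul_inv]
  refine inv_anti₀ (by positivity) (le_trans ?_ h)
  gcongr
  rw [hqn]
  have : 1 / x = 1 / (2 * x) + 1 / (2 * x) := by field_simp; norm_num
  linarith

/-- On the real axis, `(q; q)_∞^(-k) = O(e^(A / x))`. -/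
lemma exists_norm_inv_eulerProd_pow_le (k : ℕ) : ∃ K, 0 ≤ K ∧ ∀ x : ℝ, 0 < x → x ≤ 1 →
    ‖((eulerProd (Complex.exp (-x))) ^ k)⁻¹‖ ≤ K * Real.exp (growth k / x) := by
  have hsub : Metric.closedBall (0 : ℂ) (1 / 2) ⊆ Metric.ball 0 1 :=
    Metric.closedBall_subset_ball (by norm_num)
  have hcont : ContinuousOn (fun q => (eulerProd q ^ k)⁻¹) (Metric.closedBall 0 (1 / 2)) := by
    refine ContinuousOn.inv₀ ?_ fun q hq =>
      pow_ne_zero _ (eulerProd_ne_zero (mem_ball_zero_iff.mp (hsub hq)))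
    exact (ModularForm.differentiableOn_tprod_one_sub_pow.continuousOn.mono hsub).pow k
  obtain ⟨D, hD⟩ := (isCompact_closedBall (0 : ℂ) (1 / 2)).exists_bound_of_continuousOn hcont
  have hD0 : 0 ≤ D := (norm_nonneg _).trans (hD 0 (by simp))
  refine ⟨(2 * Real.pi) ^ (-(k : ℝ) / 2) * D, by positivity, fun x hx hx1 => ?_⟩
  rw [inv_eulerProd_pow_exp_neg k (z := (x : ℂ)) (by simpa using hx)]
  have hQ : dualNome x ∈ Metric.closedBall (0 : ℂ) (1 / 2) := by
    rw [mem_closedBall_zero_iff, norm_dualNome, Complex.ofReal_re, Complex.norm_real,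
      Real.norm_of_nonneg hx.le]
    have h1 : x / x ^ 2 = 1 / x := by field_simp
    have h2 : 1 ≤ 1 / x := by rw [le_div_iff₀ hx]; linarith
    have h3 : Real.exp (-(4 * Real.pi ^ 2) * (x / x ^ 2)) ≤ Real.exp (-1) := by
      rw [Real.exp_le_exp, h1]
      nlinarith [Real.pi_gt_three]
    have h4 := Real.exp_neg_one_lt_d9
    linarith
  have hpow : x ^ ((k : ℝ) / 2) ≤ 1 := Real.rpow_le_one hx.le hx1 (by positivity)
  have hexp : ‖Complex.exp (-(k * (x : ℂ) / 24))‖ ≤ 1 := by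
    rw [show (-(k * (x : ℂ) / 24)) = ((-(k * x / 24) : ℝ) : ℂ) by push_cast; ring,
      ← Complex.ofReal_exp, Complex.norm_real, Real.norm_of_nonneg (Real.exp_pos _).le,
      Real.exp_le_one_iff]
    have : 0 ≤ k * x / 24 := by positivity
    linarith
  have hA : ‖Complex.exp (growth k / (x : ℂ))‖ = Real.exp (growth k / x) := by
    rw [norm_exp_inv, Complex.ofReal_re, Complex.norm_real, Real.norm_of_nonneg hx.le]
    congr 1
    field_simp
  rw [norm_mul, norm_mul, norm_mul, norm_mul, Complex.norm_cpow_real, Complex.norm_real,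
    Complex.norm_real, Real.norm_of_nonneg hx.le,
    Real.norm_of_nonneg (by positivity : (0 : ℝ) ≤ (2 * Real.pi) ^ (-(k : ℝ) / 2)), hA]
  calc _ ≤ (2 * Real.pi) ^ (-(k : ℝ) / 2) * 1 * 1 * Real.exp (growth k / x) * D := by
        gcongr
        exact hD _ hQ
    _ = _ := by ring

/-! ### Hankel's formula on vertical lines -/

open MeasureTheory in
/-- Euler's integral `∫_0^∞ t^(σ-1) e^(-r t) dt = Γ(σ) r^(-σ)` for complex `r`, by analytic
continuation from real `r`. -/
lemma integral_rpow_mul_cexp {σ : ℝ} (hσ : 0 < σ) {r : ℂ} (hr : 0 < r.re) :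
    ∫ t in Set.Ioi (0 : ℝ), ((t ^ (σ - 1) : ℝ) : ℂ) * Complex.exp (-(r * t))
      = Real.Gamma σ * r ^ (-(σ : ℂ)) := by
  set U : Set ℂ := {r | 0 < r.re} with hU
  have hUo : IsOpen U := isOpen_lt continuous_const Complex.continuous_re
  have hint : ∀ {p ε : ℝ}, -1 < p → 0 < ε →
      IntegrableOn (fun t : ℝ => t ^ p * Real.exp (-ε * t)) (Set.Ioi 0) := fun hp hε => by
    simpa using integrableOn_rpow_mul_exp_neg_mul_rpow hp one_pos hε
  have hmeas : ∀ (p : ℝ) (r : ℂ), AEStronglyMeasurable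
      (fun t : ℝ => ((t ^ p : ℝ) : ℂ) * Complex.exp (-(r * t)))
      (volume.restrict (Set.Ioi 0)) := fun p r => by
    refine ContinuousOn.aestronglyMeasurable ?_ measurableSet_Ioi
    refine ContinuousOn.mul (Complex.continuous_ofReal.comp_continuousOn fun t ht => ?_)
      (by fun_prop)
    exact (Real.continuousAt_rpow_const t p (Or.inl (ne_of_gt ht))).continuousWithinAt
  have hnorm : ∀ (r : ℂ) (t : ℝ), ‖Complex.exp (-(r * t))‖ = Real.exp (-(r.re * t)) := fun r t => by
    rw [Complex.norm_exp, Complex.neg_re, Complex.re_mul_ofReal]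
  have hF : DifferentiableOn ℂ (fun r : ℂ => ∫ t in Set.Ioi (0 : ℝ),
      ((t ^ (σ - 1) : ℝ) : ℂ) * Complex.exp (-(r * t))) U := by
    intro r₀ hr₀
    have hr₀' : 0 < r₀.re := hr₀
    have hnhds : {r : ℂ | r₀.re / 2 < r.re} ∈ 𝓝 r₀ :=
      (isOpen_lt continuous_const Complex.continuous_re).mem_nhds (by
        show r₀.re / 2 < r₀.re; linarith)
    refine (hasDerivAt_integral_of_dominated_loc_of_deriv_le hnhds
      (bound := fun t => t ^ σ * Real.exp (-(r₀.re / 2) * t))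
      (F' := fun r t => ((t ^ σ : ℝ) : ℂ) * Complex.exp (-(r * t)) * (-1))
      (Eventually.of_forall fun r => hmeas _ r) ?_ ((hmeas σ r₀).mul_const _) ?_
      (hint (by linarith) (by linarith)) ?_).2.differentiableAt.differentiableWithinAt
    · refine (hint (p := σ - 1) (by linarith) hr₀').mono' (hmeas _ _) ?_
      filter_upwards [ae_restrict_mem measurableSet_Ioi] with t ht
      rw [norm_mul, hnorm, Complex.norm_real, Real.norm_of_nonneg (Real.rpow_nonneg (le_of_lt ht) _)]
      rw [neg_mul]
    · filter_upwards [ae_restrict_mem measurableSet_Ioi] with t ht r hr'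
      have ht' : 0 < t := ht
      have hr'' : r₀.re / 2 < r.re := hr'
      rw [norm_mul, norm_mul, hnorm, Complex.norm_real, Real.norm_of_nonneg (by positivity),
        norm_neg, norm_one, mul_one]
      gcongr
      nlinarith
    · filter_upwards [ae_restrict_mem measurableSet_Ioi] with t ht r _
      have ht' : 0 < t := ht
      have h1 : HasDerivAt (fun r : ℂ => -(r * t)) (-(1 * (t : ℂ))) r :=
        ((hasDerivAt_id r).mul_const (t : ℂ)).neg
      refine (h1.cexp.const_mul ((t ^ (σ - 1) : ℝ) : ℂ)).congr_deriv ?_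
      have h2 : t ^ σ = t ^ (σ - 1) * t := by
        rw [← Real.rpow_add_one ht'.ne']; ring_nf
      rw [h2]
      push_cast
      ring
  have hG : DifferentiableOn ℂ (fun r : ℂ => (Real.Gamma σ : ℂ) * r ^ (-(σ : ℂ))) U := by
    intro r hr
    exact ((differentiableAt_id.cpow_const (Or.inl hr)).const_mul _).differentiableWithinAt
  have hreal : ∀ x : ℝ, 0 < x → ∫ t in Set.Ioi (0 : ℝ),
      ((t ^ (σ - 1) : ℝ) : ℂ) * Complex.exp (-((x : ℂ) * t))
      = Real.Gamma σ * (x : ℂ) ^ (-(σ : ℂ)) := by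
    intro x hx
    have h := Real.integral_rpow_mul_exp_neg_mul_Ioi hσ hx
    have h2 : ∫ t in Set.Ioi (0 : ℝ), ((t ^ (σ - 1) : ℝ) : ℂ) * Complex.exp (-((x : ℂ) * t))
        = ((∫ t in Set.Ioi (0 : ℝ), t ^ (σ - 1) * Real.exp (-(x * t)) : ℝ) : ℂ) := by
      rw [← integral_complex_ofReal]
      push_cast
      rfl
    rw [h2, h, one_div, Real.inv_rpow hx.le, ← Real.rpow_neg hx.le]
    push_cast
    rw [Complex.ofReal_cpow hx.le]
    push_cast
    ring
  have hfreq : ∃ᶠ r : ℂ in 𝓝[≠] 1, ∫ t in Set.Ioi (0 : ℝ),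
      ((t ^ (σ - 1) : ℝ) : ℂ) * Complex.exp (-(r * t)) = Real.Gamma σ * r ^ (-(σ : ℂ)) := by
    have ht : Tendsto (fun n : ℕ => ((1 + 1 / ((n : ℝ) + 1) : ℝ) : ℂ)) atTop (𝓝[≠] 1) := by
      rw [tendsto_nhdsWithin_iff]
      constructor
      · have := (Complex.continuous_ofReal.tendsto (1 + 0)).comp
          (tendsto_one_div_add_atTop_nhds_zero_nat.const_add (1 : ℝ))
        simpa [Function.comp_def] using this
      · refine Eventually.of_forall fun n => ?_
        have : (0 : ℝ) < 1 / ((n : ℝ) + 1) := by positivity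
        simp only [Set.mem_compl_iff, Set.mem_singleton_iff]
        intro h
        have h' : (1 + 1 / ((n : ℝ) + 1) : ℝ) = 1 := by exact_mod_cast h
        linarith
    exact ht.frequently (Frequently.of_forall fun n => hreal _ (by positivity))
  exact (hF.analyticOnNhd hUo).eqOn_of_preconnected_of_frequently_eq (hG.analyticOnNhd hUo)
    (convex_halfSpace_re_gt 0).isPreconnected (by simp [hU]) hfreq hr

lemma integrable_and_integral_inv_sq_add_sq {x : ℝ} (hx : 0 < x) :
    MeasureTheory.Integrable (fun y : ℝ => (x ^ 2 + y ^ 2)⁻¹) ∧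
      ∫ y : ℝ, (x ^ 2 + y ^ 2)⁻¹ = Real.pi / x := by
  have h : (fun y : ℝ => (x ^ 2 + y ^ 2)⁻¹) = fun y => (x ^ 2)⁻¹ * (1 + (y / x) ^ 2)⁻¹ := by
    funext y
    rw [← mul_inv]
    congr 1
    field_simp
  rw [h]
  constructor
  · exact (integrable_inv_one_add_sq.comp_div hx.ne').const_mul _
  · rw [MeasureTheory.integral_const_mul,
      MeasureTheory.Measure.integral_comp_div (fun y : ℝ => (1 + y ^ 2)⁻¹),
      integral_univ_inv_one_add_sq, abs_of_pos hx, smul_eq_mul]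
    field_simp

lemma re_add_mul_I (x y : ℝ) : ((x : ℂ) + y * Complex.I).re = x := by simp

lemma sq_norm_add_mul_I (x y : ℝ) : ‖(x : ℂ) + y * Complex.I‖ ^ 2 = x ^ 2 + y ^ 2 := by
  rw [Complex.sq_norm, Complex.normSq_add_mul_I]

lemma add_mul_I_ne_zero {x : ℝ} (hx : 0 < x) (y : ℝ) : (x : ℂ) + y * Complex.I ≠ 0 := by
  intro h
  have := congrArg Complex.re h
  rw [re_add_mul_I] at this
  exact hx.ne' this

lemma le_norm_add_mul_I (x y : ℝ) : x ≤ ‖(x : ℂ) + y * Complex.I‖ := by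
  have := Complex.re_le_norm ((x : ℂ) + y * Complex.I)
  rwa [re_add_mul_I] at this

lemma continuous_add_mul_I_cpow {x : ℝ} (hx : 0 < x) (c : ℂ) :
    Continuous fun y : ℝ => ((x : ℂ) + y * Complex.I) ^ c :=
  Continuous.cpow (by fun_prop) continuous_const fun y => Or.inl (by rwa [re_add_mul_I])

lemma norm_add_mul_I_cpow_le {x : ℝ} (hx : 0 < x) (y : ℝ) {p : ℝ} (hp : p ≤ -2) :
    ‖((x : ℂ) + y * Complex.I) ^ (p : ℂ)‖ ≤ x ^ (p + 2) * (x ^ 2 + y ^ 2)⁻¹ := by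
  have hn := le_norm_add_mul_I x y
  have hn0 : 0 < ‖(x : ℂ) + y * Complex.I‖ := hx.trans_le hn
  rw [Complex.norm_cpow_real, ← sq_norm_add_mul_I]
  have h1 : ‖(x : ℂ) + y * Complex.I‖ ^ p = ‖(x : ℂ) + y * Complex.I‖ ^ (p + 2)
      * (‖(x : ℂ) + y * Complex.I‖ ^ 2)⁻¹ := by
    rw [← Real.rpow_natCast, ← Real.rpow_neg hn0.le, ← Real.rpow_add hn0]
    congr 1
    push_cast
    ring
  rw [h1]
  gcongr ?_ * _
  exact Real.rpow_le_rpow_of_nonpos hx hn (by linarith)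

lemma integrable_add_mul_I_cpow {x : ℝ} (hx : 0 < x) {p : ℝ} (hp : p ≤ -2) :
    MeasureTheory.Integrable fun y : ℝ => ((x : ℂ) + y * Complex.I) ^ (p : ℂ) :=
  ((integrable_and_integral_inv_sq_add_sq hx).1.const_mul _).mono'
    (continuous_add_mul_I_cpow hx _).aestronglyMeasurable
    (Eventually.of_forall fun y => norm_add_mul_I_cpow_le hx y hp)

open MeasureTheory in
/-- Hankel's formula `t^(σ-1) / Γ(σ) = (1 / 2πi) ∫ z^(-σ) e^(t z) dz` on a vertical line, by Fourier
inversion for `u ↦ u^(σ-1) e^(-x u)` on `u > 0`. -/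
lemma integral_cpow_mul_exp_vertical {x t σ : ℝ} (hx : 0 < x) (ht : 0 < t) (hσ : 2 ≤ σ) :
    ∫ y : ℝ, ((x : ℂ) + y * Complex.I) ^ ((-σ : ℝ) : ℂ) * Complex.exp (t * (x + y * Complex.I))
      = ((2 * Real.pi * (t ^ (σ - 1) / Real.Gamma σ) : ℝ) : ℂ) := by
  set g : ℝ → ℂ := fun u => (((max u 0) ^ (σ - 1) * Real.exp (-(x * u)) : ℝ) : ℂ) with hg
  have hgc : Continuous g := by
    have : Continuous fun u : ℝ => (max u 0) ^ (σ - 1) :=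
      (continuous_id.max continuous_const).rpow_const fun u => Or.inr (by linarith)
    exact Complex.continuous_ofReal.comp (this.mul (by fun_prop))
  have hg0 : ∀ u ∉ Set.Ioi (0 : ℝ), g u = 0 := fun u hu => by
    rw [hg]
    simp only
    rw [max_eq_right (not_lt.mp hu), Real.zero_rpow (by linarith), zero_mul, Complex.ofReal_zero]
  have hgi : Integrable g := by
    have h1 : IntegrableOn g (Set.Ioi 0) := by
      refine Integrable.ofReal ?_
      have := integrableOn_rpow_mul_exp_neg_mul_rpow (p := 1) (s := σ - 1) (b := x) (by linarith)
        one_pos hx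
      refine this.congr ?_
      filter_upwards [ae_restrict_mem measurableSet_Ioi] with u hu
      rw [max_eq_left (le_of_lt hu), Real.rpow_one, neg_mul]
      rfl
    have h2 : Function.support g ⊆ Set.Ioi 0 := fun u hu => by
      by_contra h
      exact hu (hg0 u h)
    exact (integrableOn_iff_integrable_of_support_subset h2).mp h1
  have hF : ∀ ξ : ℝ, FourierTransform.fourier g ξ
      = Real.Gamma σ * ((x : ℂ) + ((2 * Real.pi * ξ : ℝ) : ℂ) * Complex.I) ^ ((-σ : ℝ) : ℂ) := by
    intro ξ
    rw [Real.fourier_real_eq_integral_exp_smul,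
      ← setIntegral_eq_integral_of_forall_compl_eq_zero (s := Set.Ioi 0) fun u hu => by
        rw [hg0 u hu, smul_zero], Complex.ofReal_neg,
      ← integral_rpow_mul_cexp (by linarith) (by rwa [re_add_mul_I])]
    refine setIntegral_congr_fun measurableSet_Ioi fun u hu => ?_
    rw [hg]
    simp only [smul_eq_mul]
    rw [max_eq_left (le_of_lt hu)]
    push_cast
    rw [mul_left_comm, ← Complex.exp_add]
    congr 2
    ring
  have hFi : Integrable (FourierTransform.fourier g) := by
    have h1 := ((integrable_add_mul_I_cpow hx (p := -σ) (by linarith)).comp_mul_left'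
      (R := 2 * Real.pi) (by positivity)).const_mul (Real.Gamma σ : ℂ)
    exact h1.congr (Eventually.of_forall fun ξ => (hF ξ).symm)
  have hinv := congrFun (hgc.fourierInv_fourier_eq hgi hFi) t
  rw [Real.fourierInv_eq'] at hinv
  have hΓ : Real.Gamma σ ≠ 0 := (Real.Gamma_pos_of_pos (by linarith)).ne'
  have hcv := Measure.integral_comp_mul_left (fun y : ℝ => ((x : ℂ) + y * Complex.I) ^ ((-σ : ℝ) : ℂ)
    * Complex.exp (t * (x + y * Complex.I))) (2 * Real.pi)
  have h2 : ∫ ξ : ℝ, ((x : ℂ) + ((2 * Real.pi * ξ : ℝ) : ℂ) * Complex.I) ^ ((-σ : ℝ) : ℂ)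
      * Complex.exp (t * (x + ((2 * Real.pi * ξ : ℝ) : ℂ) * Complex.I))
      = Complex.exp (t * x) * ((Real.Gamma σ : ℂ))⁻¹ * g t := by
    rw [← hinv, ← integral_const_mul]
    refine integral_congr_ae (Eventually.of_forall fun ξ => ?_)
    simp only [hF, smul_eq_mul]
    rw [mul_add, Complex.exp_add]
    have h3 : Complex.exp (↑(2 * Real.pi * inner ℝ ξ t) * Complex.I)
        = Complex.exp (t * (((2 * Real.pi * ξ : ℝ) : ℂ) * Complex.I)) := by
      congr 1
      simp only [RCLike.inner_apply, conj_trivial]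
      push_cast
      ring
    rw [h3]
    have hΓ' : (Real.Gamma σ : ℂ) ≠ 0 := by exact_mod_cast hΓ
    field_simp
  rw [h2] at hcv
  have h4 : (∫ y : ℝ, ((x : ℂ) + y * Complex.I) ^ ((-σ : ℝ) : ℂ)
      * Complex.exp (t * (x + y * Complex.I)))
      = 2 * Real.pi * (Complex.exp (t * x) * ((Real.Gamma σ : ℂ))⁻¹ * g t) := by
    rw [hcv, abs_of_pos (by positivity), Complex.real_smul]
    generalize (∫ y : ℝ, ((x : ℂ) + y * Complex.I) ^ ((-σ : ℝ) : ℂ)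
      * Complex.exp (t * (x + y * Complex.I))) = Y
    have := Complex.ofReal_ne_zero.mpr Real.pi_ne_zero
    push_cast
    field_simp
  rw [h4, hg]
  simp only
  rw [max_eq_left ht.le]
  have h5 : Complex.exp (t * x) * Complex.exp (-(x * t)) = 1 := by
    rw [← Complex.exp_add]; ring_nf; simp
  push_cast
  linear_combination (2 * Real.pi * ((t ^ (σ - 1) : ℝ) : ℂ) * ((Real.Gamma σ : ℂ))⁻¹) * h5

/-! ### Comparison with the Bessel series -/

/-- The terms of the power series in `A` of `(1 / 2πi) ∫ z^s e^(A/z + t z) dz`. Where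
`j - s` is a pole of `Γ`, the term is `0` by Mathlib's convention, in accordance with `1 / Γ = 0`. -/
def besselTerm (s A t : ℝ) (j : ℕ) : ℝ :=
  A ^ j * t ^ ((j : ℝ) - s - 1) / (j.factorial * Real.Gamma (j - s))

lemma mainFactor_eq_tsum {k : ℕ} (hk : 1 ≤ k) (ℓ : ℕ) {n : ℕ} (hn : 1 ≤ n) :
    mainFactor k ℓ n = ∑' j, besselTerm (ℓ + k / 2) (growth k) n j := by
  have hk0 : (0 : ℝ) < k := by exact_mod_cast hk
  have hn0 : (0 : ℝ) < n := by exact_mod_cast hn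
  have hp := Real.pi_pos
  set a := Real.pi * √((k : ℝ) / 6) with ha
  have ha0 : 0 < a := by positivity
  have ha2 : a ^ 2 = growth k := by
    rw [ha, mul_pow, Real.sq_sqrt (by positivity), growth]; ring
  have harg : Real.pi * √(2 * (k : ℝ) * n / 3) / 2 = a * √(n : ℝ) := by
    have : 2 * (k : ℝ) * n / 3 = 2 ^ 2 * ((k : ℝ) / 6) * n := by ring
    rw [this, Real.sqrt_mul (by positivity), Real.sqrt_mul (by positivity),
      Real.sqrt_sq (by norm_num), ha]
    ring
  rw [mainFactor, besselI, ← tsum_mul_left]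
  refine tsum_congr fun j => ?_
  rw [harg, besselTerm, ← ha2, ← ha, Real.mul_rpow ha0.le (Real.sqrt_nonneg _), Real.sqrt_eq_rpow,
    ← Real.rpow_mul hn0.le, ← pow_mul, ← Real.rpow_natCast a]
  have h1 : a ^ (((2 * j : ℕ) : ℝ)) = a ^ (1 + (ℓ : ℝ) + (k : ℝ) / 2)
      * a ^ (2 * (j : ℝ) + (-1 - (ℓ : ℝ) - (k : ℝ) / 2)) := by
    rw [← Real.rpow_add ha0]; congr 1; push_cast; ring
  have h2 : (n : ℝ) ^ ((j : ℝ) - (ℓ + k / 2) - 1) = (n : ℝ) ^ (-(2 + 2 * (ℓ : ℝ) + k) / 4)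
      * (n : ℝ) ^ (1 / 2 * (2 * (j : ℝ) + (-1 - (ℓ : ℝ) - (k : ℝ) / 2))) := by
    rw [← Real.rpow_add hn0]; congr 1; ring
  have h3 : (-1 - (ℓ : ℝ) - (k : ℝ) / 2 + j + 1) = (j : ℝ) - (ℓ + k / 2) := by ring
  rw [h1, h2, h3]
  ring

/-- The remainder of the exponential series after `J` terms. -/
def expTail (J : ℕ) (u : ℂ) : ℂ := Complex.exp u - ∑ i ∈ Finset.range J, u ^ i / i.factorial

lemma hasSum_expTail (J : ℕ) (u : ℂ) :
    HasSum (fun j : ℕ => u ^ (j + J) / (j + J).factorial) (expTail J u) := by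
  have h : HasSum (fun n : ℕ => u ^ n / n.factorial) (Complex.exp u) := by
    rw [Complex.exp_eq_exp_ℂ]
    exact NormedSpace.expSeries_div_hasSum_exp u
  exact (hasSum_nat_add_iff' J).mpr h

lemma norm_exp_mul_add_mul_I (t x y : ℝ) :
    ‖Complex.exp (t * (x + y * Complex.I))‖ = Real.exp (t * x) := by
  rw [Complex.norm_exp, Complex.re_ofReal_mul, re_add_mul_I]

lemma cpow_neg_sub_natCast {z : ℂ} (hz : z ≠ 0) (s : ℝ) (i : ℕ) :
    z ^ ((-((i : ℝ) - s) : ℝ) : ℂ) = z ^ (s : ℂ) * (z ^ i)⁻¹ := by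
  rw [show ((-((i : ℝ) - s) : ℝ) : ℂ) = (s : ℂ) - (i : ℂ) by push_cast; ring,
    Complex.cpow_sub _ _ hz, Complex.cpow_natCast, div_eq_mul_inv]

/-- Termwise application of Hankel's formula. The first `J` terms are left out because the
corresponding integrals do not converge absolutely. -/
lemma hasSum_besselTerm_tail {s A t x : ℝ} (hA : 0 < A) (ht : 0 < t) (hx : 0 < x) {J : ℕ}
    (hJ : s + 2 ≤ J) :
    HasSum (fun j => ((2 * Real.pi * besselTerm s A t (j + J) : ℝ) : ℂ))
      (∫ y : ℝ, ((x : ℂ) + y * Complex.I) ^ (s : ℂ) * Complex.exp (t * (x + y * Complex.I))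
        * expTail J (A / (x + y * Complex.I))) := by
  obtain ⟨hI, hIv⟩ := integrable_and_integral_inv_sq_add_sq hx
  set F : ℕ → ℝ → ℂ := fun j y => ((A ^ (j + J) / (j + J).factorial : ℝ) : ℂ)
    * (((x : ℂ) + y * Complex.I) ^ ((-(((j + J : ℕ) : ℝ) - s) : ℝ) : ℂ)
      * Complex.exp (t * (x + y * Complex.I))) with hF
  have hσ : ∀ j : ℕ, 2 ≤ ((j + J : ℕ) : ℝ) - s := fun j => by
    push_cast
    have : (0 : ℝ) ≤ j := Nat.cast_nonneg j
    linarith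
  have hFb : ∀ j y, ‖F j y‖ ≤ (A ^ (j + J) / (j + J).factorial
      * (x ^ (-(((j + J : ℕ) : ℝ) - s) + 2) * Real.exp (t * x))) * (x ^ 2 + y ^ 2)⁻¹ := by
    intro j y
    have h := norm_add_mul_I_cpow_le hx y (p := -(((j + J : ℕ) : ℝ) - s)) (by linarith [hσ j])
    rw [hF]
    simp only
    rw [norm_mul, norm_mul, norm_exp_mul_add_mul_I, Complex.norm_real,
      Real.norm_of_nonneg (by positivity)]
    calc _ ≤ A ^ (j + J) / (j + J).factorial * ((x ^ (-(((j + J : ℕ) : ℝ) - s) + 2)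
          * (x ^ 2 + y ^ 2)⁻¹) * Real.exp (t * x)) := by gcongr
      _ = _ := by ring
  have hFi : ∀ j, MeasureTheory.Integrable (F j) := fun j => by
    refine (hI.const_mul _).mono' ?_ (Eventually.of_forall (hFb j))
    exact (continuous_const.mul ((continuous_add_mul_I_cpow hx _).mul
      (by fun_prop))).aestronglyMeasurable
  have hsum : Summable fun j => ∫ y, ‖F j y‖ := by
    have h1 : Summable fun j : ℕ => (A / x) ^ (j + J) / (j + J).factorial :=
      (summable_nat_add_iff J).mpr (Real.summable_pow_div_factorial (A / x))
    refine Summable.of_nonneg_of_le (fun j => MeasureTheory.integral_nonneg fun y => norm_nonneg _)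
      (fun j => ?_) (h1.mul_right (x ^ (s + 2) * Real.exp (t * x) * (Real.pi / x)))
    refine (MeasureTheory.integral_mono (hFi j).norm (hI.const_mul _) (hFb j)).trans ?_
    rw [MeasureTheory.integral_const_mul, hIv]
    refine le_of_eq ?_
    have h2 : x ^ (-(((j + J : ℕ) : ℝ) - s) + 2) = x ^ (s + 2) * (x ^ (j + J))⁻¹ := by
      rw [← Real.rpow_natCast x, ← Real.rpow_neg hx.le, ← Real.rpow_add hx]
      congr 1; ring
    rw [h2, div_pow]
    field_simp
  have h := MeasureTheory.hasSum_integral_of_summable_integral_norm hFi hsum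
  have hval : ∀ j, ∫ y, F j y = ((2 * Real.pi * besselTerm s A t (j + J) : ℝ) : ℂ) := by
    intro j
    rw [hF]
    simp only
    rw [MeasureTheory.integral_const_mul, integral_cpow_mul_exp_vertical hx ht (hσ j),
      ← Complex.ofReal_mul, besselTerm]
    congr 1
    have := (Real.Gamma_pos_of_pos (by linarith [hσ j] : 0 < ((j + J : ℕ) : ℝ) - s)).ne'
    field_simp
  simp_rw [hval] at h
  have hfun : (fun y : ℝ => ((x : ℂ) + y * Complex.I) ^ (s : ℂ)
      * Complex.exp (t * (x + y * Complex.I)) * expTail J (A / (x + y * Complex.I)))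
      = fun y => ∑' j, F j y := by
    funext y
    have hz := add_mul_I_ne_zero hx y
    rw [← ((hasSum_expTail J (A / (x + y * Complex.I))).mul_left
      (((x : ℂ) + y * Complex.I) ^ (s : ℂ) * Complex.exp (t * (x + y * Complex.I)))).tsum_eq]
    refine tsum_congr fun j => ?_
    rw [hF]
    simp only
    rw [cpow_neg_sub_natCast hz, div_pow]
    push_cast
    field_simp
  rw [hfun]
  exact h

lemma norm_add_mul_I_le {x y : ℝ} (hx : 0 < x) (hy : |y| ≤ 2 * Real.pi * x) :
    ‖(x : ℂ) + y * Complex.I‖ ≤ (1 + 2 * Real.pi) * x := by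
  refine (norm_add_le _ _).trans ?_
  rw [norm_mul, Complex.norm_I, Complex.norm_real, Complex.norm_real, Real.norm_of_nonneg hx.le,
    Real.norm_eq_abs]
  linarith

lemma continuous_div_add_mul_I {x : ℝ} (hx : 0 < x) (A : ℂ) :
    Continuous fun y : ℝ => A / ((x : ℂ) + y * Complex.I) :=
  continuous_const.div (by fun_prop) (add_mul_I_ne_zero hx)

/-- The integral over the segment `|y| ≤ 2πx` differs from the complete Bessel series by the
first `J` terms, both as terms of the series and as integrals over the segment, and by the integral
of the remaining terms over the rest of the line, on which `|A / z| ≤ A / (2πx)`. -/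
lemma norm_tsum_besselTerm_sub_le {s A t x : ℝ} (hs : 0 ≤ s) (hA : 0 < A) (ht : 0 < t) (hx : 0 < x)
    {J : ℕ} (hJ : s + 2 ≤ J) :
    ‖((2 * Real.pi * ∑' j, besselTerm s A t j : ℝ) : ℂ)
      - ∫ y in -(2 * Real.pi * x)..2 * Real.pi * x, ((x : ℂ) + y * Complex.I) ^ (s : ℂ)
        * Complex.exp (A / (x + y * Complex.I)) * Complex.exp (t * (x + y * Complex.I))‖
    ≤ ∑ i ∈ Finset.range J, 2 * Real.pi * |besselTerm s A t i|
      + ∑ i ∈ Finset.range J, 4 * Real.pi * x * (((1 + 2 * Real.pi) * x) ^ s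
          * Real.exp (t * x) * ((A / x) ^ i / i.factorial))
      + A ^ J * x ^ (s + 2 - J) * (Real.pi / x) * Real.exp (t * x + A / (2 * Real.pi * x)) := by
  obtain ⟨hI, hIv⟩ := integrable_and_integral_inv_sq_add_sq hx
  have hp := Real.pi_pos
  set S : Set ℝ := Set.Ioc (-(2 * Real.pi * x)) (2 * Real.pi * x) with hS
  have hle : -(2 * Real.pi * x) ≤ 2 * Real.pi * x := by nlinarith [mul_pos hp hx]
  set P : ℝ → ℂ := fun y => ((x : ℂ) + y * Complex.I) ^ (s : ℂ)
    * Complex.exp (t * (x + y * Complex.I)) with hP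
  set u : ℝ → ℂ := fun y => A / ((x : ℂ) + y * Complex.I) with hu
  have hPc : Continuous P := (continuous_add_mul_I_cpow hx _).mul (by fun_prop)
  have huc : Continuous u := continuous_div_add_mul_I hx A
  have htail := hasSum_besselTerm_tail hA ht hx hJ
  have htail' : HasSum (fun j => ((2 * Real.pi * besselTerm s A t (j + J) : ℝ) : ℂ))
    (∫ y, P y * expTail J (u y)) := htail
  -- The complete series, through Hankel's formula for the terms from `J` on.
  have hser : ((2 * Real.pi * ∑' j, besselTerm s A t j : ℝ) : ℂ)
      = ((∑ i ∈ Finset.range J, 2 * Real.pi * besselTerm s A t i : ℝ) : ℂ)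
        + ∫ y, P y * expTail J (u y) := by
    have h1 : HasSum (fun j => ((2 * Real.pi * besselTerm s A t j : ℝ) : ℂ))
        ((∫ y, P y * expTail J (u y))
          + ∑ i ∈ Finset.range J, ((2 * Real.pi * besselTerm s A t i : ℝ) : ℂ)) :=
      (hasSum_nat_add_iff J).mp htail'
    rw [← tsum_mul_left, Complex.ofReal_tsum, h1.tsum_eq, add_comm]
    push_cast
    rfl
  have hub : ∀ y, ‖P y‖ * ‖u y‖ ^ J ≤ A ^ J * x ^ (s + 2 - J) * Real.exp (t * x)
      * (x ^ 2 + y ^ 2)⁻¹ := by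
    intro y
    have h := norm_add_mul_I_cpow_le hx y (p := -((J : ℝ) - s)) (by linarith)
    have hz := add_mul_I_ne_zero hx y
    have hz0 := norm_pos_iff.mpr hz
    rw [cpow_neg_sub_natCast hz, norm_mul, norm_inv, norm_pow] at h
    simp only [hP, hu]
    rw [norm_mul, norm_exp_mul_add_mul_I, norm_div, Complex.norm_real, Real.norm_of_nonneg hA.le,
      div_pow]
    calc _ = A ^ J * Real.exp (t * x) * (‖((x : ℂ) + y * Complex.I) ^ (s : ℂ)‖
          * (‖(x : ℂ) + y * Complex.I‖ ^ J)⁻¹) := by field_simp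
      _ ≤ A ^ J * Real.exp (t * x) * (x ^ (-((J : ℝ) - s) + 2) * (x ^ 2 + y ^ 2)⁻¹) := by gcongr
      _ = _ := by rw [show -((J : ℝ) - s) + 2 = s + 2 - J by ring]; ring
  have hGb : ∀ y, ‖P y * expTail J (u y)‖ ≤ A ^ J * x ^ (s + 2 - J) * Real.exp (t * x)
      * (x ^ 2 + y ^ 2)⁻¹ * Real.exp ‖u y‖ := by
    intro y
    rw [norm_mul]
    have h1 := Complex.norm_exp_sub_sum_le_norm_mul_exp (u y) J
    calc _ ≤ ‖P y‖ * (‖u y‖ ^ J * Real.exp ‖u y‖) := by gcongr; exact h1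
      _ = (‖P y‖ * ‖u y‖ ^ J) * Real.exp ‖u y‖ := by ring
      _ ≤ _ := mul_le_mul_of_nonneg_right (hub y) (Real.exp_pos _).le
  have hGc : Continuous fun y => P y * expTail J (u y) := by
    unfold expTail
    fun_prop
  have hGi : MeasureTheory.Integrable fun y => P y * expTail J (u y) := by
    refine (hI.const_mul (A ^ J * x ^ (s + 2 - J) * Real.exp (t * x) * Real.exp (A / x))).mono'
      hGc.aestronglyMeasurable (Eventually.of_forall fun y => (hGb y).trans ?_)
    have h1 : ‖u y‖ ≤ A / x := by
      simp only [hu]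
      rw [norm_div, Complex.norm_real, Real.norm_of_nonneg hA.le]
      exact div_le_div_of_nonneg_left hA.le hx (le_norm_add_mul_I x y)
    calc _ ≤ A ^ J * x ^ (s + 2 - J) * Real.exp (t * x) * (x ^ 2 + y ^ 2)⁻¹ * Real.exp (A / x) := by
          gcongr
      _ = _ := by ring
  have hsplit := MeasureTheory.integral_add_compl (s := S) measurableSet_Ioc hGi
  rw [hS, ← intervalIntegral.integral_of_le hle, ← hS] at hsplit
  have hseg : ∫ y in -(2 * Real.pi * x)..2 * Real.pi * x, P y * expTail J (u y)
      = (∫ y in -(2 * Real.pi * x)..2 * Real.pi * x, ((x : ℂ) + y * Complex.I) ^ (s : ℂ)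
        * Complex.exp (A / (x + y * Complex.I)) * Complex.exp (t * (x + y * Complex.I)))
        - ∑ i ∈ Finset.range J, ∫ y in -(2 * Real.pi * x)..2 * Real.pi * x,
          P y * (u y ^ i / i.factorial) := by
    rw [← intervalIntegral.integral_finsetSum fun i _ =>
      (Continuous.intervalIntegrable (by fun_prop) _ _), ← intervalIntegral.integral_sub]
    · refine intervalIntegral.integral_congr fun y _ => ?_
      simp only [hP, hu, expTail, ← Finset.mul_sum]
      ring
    · refine Continuous.intervalIntegrable ?_ _ _
      exact ((continuous_add_mul_I_cpow hx _).mul (continuous_div_add_mul_I hx A).cexp).mul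
        (by fun_prop)
    · exact Continuous.intervalIntegrable (by fun_prop) _ _
  have hpoly : ∀ i ∈ Finset.range J, ‖∫ y in -(2 * Real.pi * x)..2 * Real.pi * x,
      P y * (u y ^ i / i.factorial)‖ ≤ 4 * Real.pi * x * (((1 + 2 * Real.pi) * x) ^ s
          * Real.exp (t * x) * ((A / x) ^ i / i.factorial)) := by
    intro i _
    refine (intervalIntegral.norm_integral_le_of_norm_le_const (C := ((1 + 2 * Real.pi) * x) ^ s
      * Real.exp (t * x) * ((A / x) ^ i / i.factorial)) fun y hy => ?_).trans (le_of_eq ?_)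
    · rw [Set.uIoc_of_le hle] at hy
      have hyabs : |y| ≤ 2 * Real.pi * x := abs_le.mpr ⟨hy.1.le, hy.2⟩
      simp only [hP, hu]
      rw [norm_mul, norm_mul, norm_div, norm_pow, norm_div, norm_exp_mul_add_mul_I,
        Complex.norm_natCast, Complex.norm_real, Real.norm_of_nonneg hA.le, Complex.norm_cpow_real]
      gcongr
      · exact norm_add_mul_I_le hx hyabs
      · exact le_norm_add_mul_I x y
    · rw [abs_of_nonneg (by linarith)]
      ring
  have hcompl : ‖∫ y in Sᶜ, P y * expTail J (u y)‖
      ≤ A ^ J * x ^ (s + 2 - J) * (Real.pi / x) * Real.exp (t * x + A / (2 * Real.pi * x)) := by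
    have hbi : MeasureTheory.Integrable fun y : ℝ => A ^ J * x ^ (s + 2 - J)
      * Real.exp (t * x + A / (2 * Real.pi * x)) * (x ^ 2 + y ^ 2)⁻¹ := hI.const_mul _
    have h1 : ‖∫ y in Sᶜ, P y * expTail J (u y)‖ ≤ ∫ y in Sᶜ, A ^ J * x ^ (s + 2 - J)
        * Real.exp (t * x + A / (2 * Real.pi * x)) * (x ^ 2 + y ^ 2)⁻¹ := by
      refine MeasureTheory.norm_integral_le_of_norm_le hbi.integrableOn ?_
      filter_upwards [MeasureTheory.ae_restrict_mem measurableSet_Ioc.compl] with y hy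
      refine (hGb y).trans ?_
      have hy' : 2 * Real.pi * x ≤ |y| := by
        by_contra h
        have := abs_lt.mp (not_le.mp h)
        exact hy ⟨this.1, this.2.le⟩
      have h2 : ‖u y‖ ≤ A / (2 * Real.pi * x) := by
        simp only [hu]
        rw [norm_div, Complex.norm_real, Real.norm_of_nonneg hA.le]
        refine div_le_div_of_nonneg_left hA.le (by positivity) (hy'.trans ?_)
        have := Complex.abs_im_le_norm ((x : ℂ) + y * Complex.I)
        simpa using this
      rw [Real.exp_add]
      calc _ ≤ A ^ J * x ^ (s + 2 - J) * Real.exp (t * x) * (x ^ 2 + y ^ 2)⁻¹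
            * Real.exp (A / (2 * Real.pi * x)) := by gcongr
        _ = _ := by ring
    refine h1.trans ((MeasureTheory.setIntegral_le_integral hbi
      (Eventually.of_forall fun y => by positivity)).trans (le_of_eq ?_))
    rw [MeasureTheory.integral_const_mul, hIv]
    ring
  rw [hser, ← hsplit, hseg]
  set D : ℂ := ((∑ i ∈ Finset.range J, 2 * Real.pi * besselTerm s A t i : ℝ) : ℂ)
  have hD : ‖D‖ ≤ ∑ i ∈ Finset.range J, 2 * Real.pi * |besselTerm s A t i| := by
    rw [Complex.norm_real]
    refine (norm_sum_le _ _).trans (Finset.sum_le_sum fun i _ => ?_)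
    rw [norm_mul, Real.norm_of_nonneg (by positivity), Real.norm_eq_abs]
  have hQ := norm_sum_le_of_le _ hpoly
  set M := ∫ y in -(2 * Real.pi * x)..2 * Real.pi * x, ((x : ℂ) + y * Complex.I) ^ (s : ℂ)
        * Complex.exp (A / (x + y * Complex.I)) * Complex.exp (t * (x + y * Complex.I))
  set Q := ∑ i ∈ Finset.range J, ∫ y in -(2 * Real.pi * x)..2 * Real.pi * x,
          P y * (u y ^ i / i.factorial)
  set R := ∫ y in Sᶜ, P y * expTail J (u y)
  calc ‖D + (M - Q + R) - M‖ = ‖D + (-Q) + R‖ := by congr 1; ring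
    _ ≤ ‖D‖ + ‖-Q‖ + ‖R‖ := norm_add₃_le
    _ ≤ _ := by rw [norm_neg]; gcongr

/-! ### Orders of magnitude at the saddle point -/

lemma rpow_mul_exp_isBigO {A : ℝ} (hA : 0 < A) (a b : ℝ) {c : ℝ} (hc : c < 2) :
    (fun n : ℕ => (n : ℝ) ^ a * Real.exp (c * √(A * n)))
      =O[atTop] fun n : ℕ => (n : ℝ) ^ b * Real.exp (2 * √(A * n)) := by
  have hA' : 0 < √A := Real.sqrt_pos.mpr hA
  have h1 : Tendsto (fun n : ℕ => √(n : ℝ)) atTop atTop :=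
    Real.tendsto_sqrt_atTop.comp tendsto_natCast_atTop_atTop
  have h2 := ((isLittleO_rpow_exp_pos_mul_atTop (2 * (a - b))
    (mul_pos (sub_pos.mpr hc) hA')).comp_tendsto h1).isBigO
  have h3 := (isBigO_refl (fun n : ℕ => (n : ℝ) ^ b * Real.exp (c * √(A * n))) atTop).mul h2
  refine h3.congr' ?_ ?_
  · filter_upwards [eventually_ge_atTop 1] with n hn
    have hn0 : (0 : ℝ) < n := by exact_mod_cast hn
    simp only [Function.comp]
    rw [Real.sqrt_eq_rpow (n : ℝ), ← Real.rpow_mul hn0.le, mul_right_comm, ← Real.rpow_add hn0]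
    congr 2
    ring
  · refine Eventually.of_forall fun n => ?_
    simp only [Function.comp]
    rw [mul_assoc, ← Real.exp_add, Real.sqrt_mul hA.le]
    congr 2
    ring

lemma sqrt_div_rpow {A : ℝ} (hA : 0 < A) (n : ℕ) (p : ℝ) :
    √(A / n) ^ p = A ^ (p / 2) * (n : ℝ) ^ (-p / 2) := by
  have hn : (0 : ℝ) ≤ n := Nat.cast_nonneg n
  rw [Real.sqrt_eq_rpow, ← Real.rpow_mul (by positivity), Real.div_rpow hA.le hn, neg_div,
    Real.rpow_neg hn, div_eq_mul_inv]
  ring_nf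

lemma natCast_mul_sqrt_div {A : ℝ} (hA : 0 < A) {n : ℕ} (hn : 1 ≤ n) :
    (n : ℝ) * √(A / n) = √(A * n) := by
  have hn0 : (0 : ℝ) < n := by exact_mod_cast hn
  rw [Real.sqrt_div hA.le, Real.sqrt_mul hA.le]
  nth_rewrite 1 [← Real.mul_self_sqrt hn0.le]
  have : √(n : ℝ) ≠ 0 := (Real.sqrt_pos.mpr hn0).ne'
  field_simp

lemma div_sqrt_div {A : ℝ} (hA : 0 < A) {n : ℕ} (hn : 1 ≤ n) : A / √(A / n) = √(A * n) := by
  have hn0 : (0 : ℝ) < n := by exact_mod_cast hn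
  have h : 0 < √(A / n) := Real.sqrt_pos.mpr (by positivity)
  rw [div_eq_iff h.ne', ← natCast_mul_sqrt_div hA hn, mul_assoc, Real.mul_self_sqrt (by positivity)]
  field_simp

/-- The part `|y| ≤ 2πx`, `x = √(A / n)`, of the integral `∫ z^s e^(A/z + n z) dy`. -/
def arcIntegral (s A : ℝ) (n : ℕ) : ℂ :=
  ∫ y in -(2 * Real.pi * √(A / n))..2 * Real.pi * √(A / n),
    ((√(A / n) : ℝ) + y * Complex.I : ℂ) ^ (s : ℂ)
      * Complex.exp (A / ((√(A / n) : ℝ) + y * Complex.I))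
      * Complex.exp ((n : ℝ) * ((√(A / n) : ℝ) + y * Complex.I))

/-- Up to an exponentially smaller error, the arc integral is the complete Bessel series. -/
lemma tsum_besselTerm_sub_arcIntegral_isBigO {s A : ℝ} (hs : 0 ≤ s) (hA : 0 < A) (b : ℝ) :
    (fun n : ℕ => ((2 * Real.pi * ∑' j, besselTerm s A n j : ℝ) : ℂ) - arcIntegral s A n)
      =O[atTop] fun n : ℕ => (n : ℝ) ^ b * Real.exp (2 * √(A * n)) := by
  have hp := Real.pi_pos
  obtain ⟨J, hJ⟩ := exists_nat_ge (s + 2)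
  -- Each of the three error terms is a constant times some `n^a e^(c √(A n))` with `c < 2`.
  have h1 : (fun n : ℕ => ∑ i ∈ Finset.range J, 2 * Real.pi * |besselTerm s A n i|)
      =O[atTop] fun n : ℕ => (n : ℝ) ^ b * Real.exp (2 * √(A * n)) := by
    refine IsBigO.fun_sum fun i _ => ?_
    refine ((rpow_mul_exp_isBigO hA (i - s - 1) b (zero_lt_two)).const_mul_left
      (2 * Real.pi * |A ^ i / (i.factorial * Real.Gamma (i - s))|)).congr_left fun n => ?_
    rw [besselTerm, mul_div_right_comm, abs_mul, abs_of_nonneg (Real.rpow_nonneg n.cast_nonneg _),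
      zero_mul, Real.exp_zero]
    ring
  have h2 : (fun n : ℕ => ∑ i ∈ Finset.range J, 4 * Real.pi * √(A / n)
        * (((1 + 2 * Real.pi) * √(A / n)) ^ s
          * Real.exp (n * √(A / n)) * ((A / √(A / n)) ^ i / i.factorial)))
      =O[atTop] fun n : ℕ => (n : ℝ) ^ b * Real.exp (2 * √(A * n)) := by
    refine IsBigO.fun_sum fun i _ => ?_
    refine ((rpow_mul_exp_isBigO hA (-(1 + s - i) / 2) b (one_lt_two)).const_mul_left
      (4 * Real.pi * (1 + 2 * Real.pi) ^ s * A ^ i / i.factorial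
        * A ^ ((1 + s - i) / 2))).congr' ?_ EventuallyEq.rfl
    filter_upwards [eventually_ge_atTop 1] with n hn
    have hn0 : (0 : ℝ) < n := by exact_mod_cast hn
    have hx : 0 < √(A / n) := Real.sqrt_pos.mpr (by positivity)
    rw [← natCast_mul_sqrt_div hA hn, one_mul]
    have h3 := sqrt_div_rpow hA n (1 + s - i)
    rw [Real.rpow_sub hx, Real.rpow_add hx, Real.rpow_one, Real.rpow_natCast] at h3
    rw [Real.mul_rpow (by positivity) hx.le, div_pow]
    calc _ = 4 * Real.pi * (1 + 2 * Real.pi) ^ s * A ^ i / i.factorial * Real.exp (n * √(A / n))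
          * (A ^ ((1 + s - i) / 2) * (n : ℝ) ^ (-(1 + s - i) / 2)) := by ring
      _ = _ := by rw [← h3]; field_simp
  have h3 : (fun n : ℕ => A ^ J * √(A / n) ^ (s + 2 - J) * (Real.pi / √(A / n))
        * Real.exp (n * √(A / n) + A / (2 * Real.pi * √(A / n))))
      =O[atTop] fun n : ℕ => (n : ℝ) ^ b * Real.exp (2 * √(A * n)) := by
    have hc : 1 + 1 / (2 * Real.pi) < 2 := by
      have : 1 / (2 * Real.pi) < 1 := by
        rw [div_lt_one (by positivity)]; linarith [Real.pi_gt_three]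
      linarith
    refine ((rpow_mul_exp_isBigO hA (-(s + 1 - J) / 2) b hc).const_mul_left
      (A ^ J * Real.pi * A ^ ((s + 1 - J) / 2))).congr' ?_ EventuallyEq.rfl
    filter_upwards [eventually_ge_atTop 1] with n hn
    have hn0 : (0 : ℝ) < n := by exact_mod_cast hn
    have hx : 0 < √(A / n) := Real.sqrt_pos.mpr (by positivity)
    have h4 := sqrt_div_rpow hA n (s + 1 - J)
    have h5 : √(A / n) ^ (s + 1 - J) = √(A / n) ^ (s + 2 - J) / √(A / n) := by
      rw [← Real.rpow_sub_one hx.ne']; congr 1; ring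
    have h6 : A / (2 * Real.pi * √(A / n)) = 1 / (2 * Real.pi) * √(A * n) := by
      rw [← div_sqrt_div hA hn]; field_simp
    rw [natCast_mul_sqrt_div hA hn, h6, add_mul, one_mul]
    calc _ = A ^ J * Real.pi * Real.exp (√(A * n) + 1 / (2 * Real.pi) * √(A * n))
          * (A ^ ((s + 1 - J) / 2) * (n : ℝ) ^ (-(s + 1 - J) / 2)) := by ring
      _ = _ := by rw [← h4, h5]; ring
  refine IsBigO.trans (IsBigO.of_norm_eventuallyLE ?_) ((h1.add h2).add h3)
  filter_upwards [eventually_ge_atTop 1] with n hn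
  have hn0 : (0 : ℝ) < n := by exact_mod_cast hn
  exact norm_tsum_besselTerm_sub_le hs hA hn0 (Real.sqrt_pos.mpr (by positivity)) hJ

/-! ### Major and minor arcs -/

lemma continuous_genFun_mul_exp (k : ℕ) (m : ℤ) (n : ℕ) {x : ℝ} (hx : 0 < x) :
    Continuous fun y : ℝ => genFun k m (Complex.exp (-(x + y * Complex.I)))
      * Complex.exp (n * (x + y * Complex.I)) := by
  refine Continuous.mul ?_ (by fun_prop)
  refine (differentiableOn_genFun k m).continuousOn.comp_continuous (by fun_prop) fun y => ?_
  rw [mem_ball_zero_iff]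
  exact norm_exp_neg_lt_one (by rwa [re_add_mul_I])

/-- The coefficient integrand is negligible for `2πx ≤ |y| ≤ π`. -/
lemma exists_norm_genFun_minor_le {k : ℕ} (hk : 1 ≤ k) (m : ℤ) : ∃ K, 0 ≤ K ∧ ∀ x y : ℝ, 0 < x →
    x ≤ 1 → 2 * Real.pi * x ≤ |y| → |y| ≤ Real.pi →
    ‖genFun k m (Complex.exp (-(x + y * Complex.I)))‖
      ≤ K / x * Real.exp (growth k / x - 1 / (2 * x)) := by
  obtain ⟨K, hK0, hK⟩ := exists_norm_inv_eulerProd_pow_le k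
  refine ⟨4 * K, by positivity, fun x y hx hx1 hxy hy => ?_⟩
  set q := Complex.exp (-(x + y * Complex.I)) with hq
  have hqn : ‖q‖ = Real.exp (-x) := by rw [hq, Complex.norm_exp]; simp
  have hq1 : ‖q‖ < 1 := by rw [hqn, Real.exp_lt_one_iff]; linarith
  have h1 : ‖falseTheta m q‖ ≤ 4 / x := by
    refine (norm_falseTheta_le hq1 m).trans ?_
    have h2 := (hasSum_exp_neg_mul_and_le hx hx1).2
    rw [hqn]
    have h3 : Real.exp (-x) ^ m.natAbs ≤ 1 := pow_le_one₀ (Real.exp_pos _).le (hqn ▸ hq1.le)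
    have h4 : 0 ≤ 2 * (1 - Real.exp (-x))⁻¹ := by
      have : 0 ≤ 1 - Real.exp (-x) := by linarith [hqn ▸ hq1]
      positivity
    calc _ ≤ 2 * (1 - Real.exp (-x))⁻¹ * 1 := by gcongr
      _ ≤ 2 * (2 / x) * 1 := by gcongr
      _ = _ := by ring
  have h2 : ‖(eulerProd q ^ k)⁻¹‖ ≤ K * Real.exp (growth k / x) * Real.exp (-(1 / (2 * x))) := by
    rw [← inv_pow, norm_pow]
    refine (pow_le_pow_left₀ (norm_nonneg _) (norm_inv_eulerProd_le_minor hx hx1 hxy hy) k).trans ?_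
    rw [mul_pow, ← norm_pow, inv_pow]
    gcongr
    · exact hK x hx hx1
    · refine pow_le_of_le_one (Real.exp_pos _).le ?_ (by omega)
      rw [Real.exp_le_one_iff]
      have : 0 < 1 / (2 * x) := by positivity
      linarith
  rw [genFun, div_eq_mul_inv, norm_mul]
  calc _ ≤ 4 / x * (K * Real.exp (growth k / x) * Real.exp (-(1 / (2 * x)))) := by gcongr
    _ = _ := by rw [sub_eq_add_neg, Real.exp_add]; ring

lemma eventually_sqrt_div_lt {A ε : ℝ} (hA : 0 < A) (hε : 0 < ε) :
    ∀ᶠ n : ℕ in atTop, 0 < √(A / n) ∧ √(A / n) < ε := by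
  have h : Tendsto (fun n : ℕ => √(A / n)) atTop (𝓝 0) := by
    have := (Real.continuous_sqrt.tendsto 0).comp (tendsto_const_div_atTop_nhds_zero_nat A)
    simpa [Function.comp_def] using this
  filter_upwards [eventually_ge_atTop 1, h.eventually_lt_const hε] with n hn h2
  have hn0 : (0 : ℝ) < n := by exact_mod_cast hn
  exact ⟨Real.sqrt_pos.mpr (by positivity), h2⟩

/-- The coefficient integral may be cut down to the arc `|y| ≤ 2πx`. -/
lemma coeff_sub_arc_isBigO {k : ℕ} (hk : 1 ≤ k) (m : ℤ) (b : ℝ) :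
    (fun n : ℕ => 2 * Real.pi * coeff k m n
      - ∫ y in -(2 * Real.pi * √(growth k / n))..2 * Real.pi * √(growth k / n),
        genFun k m (Complex.exp (-((√(growth k / n) : ℝ) + y * Complex.I)))
          * Complex.exp (n * ((√(growth k / n) : ℝ) + y * Complex.I)))
      =O[atTop] fun n : ℕ => (n : ℝ) ^ b * Real.exp (2 * √(growth k * n)) := by
  have hp := Real.pi_pos
  set A := growth k with hAdef
  have hA : 0 < A := growth_pos hk
  obtain ⟨K, hK0, hK⟩ := exists_norm_genFun_minor_le hk m
  have hc : 2 - 1 / (2 * A) < 2 := by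
    have : 0 < 1 / (2 * A) := by positivity
    linarith
  refine IsBigO.trans (IsBigO.of_bound (2 * Real.pi * K * A ^ (-(1 : ℝ) / 2)) ?_)
    (rpow_mul_exp_isBigO hA (1 / 2) b hc)
  filter_upwards [eventually_ge_atTop 1, eventually_sqrt_div_lt hA (ε := 1 / 2) (by norm_num)]
    with n hn hxn
  obtain ⟨hx, hx2⟩ := hxn
  have hrpow := sqrt_div_rpow hA n (-1)
  set x := √(A / n) with hxdef
  set f : ℝ → ℂ := fun y => genFun k m (Complex.exp (-(x + y * Complex.I)))
      * Complex.exp (n * (x + y * Complex.I)) with hf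
  have hfc : Continuous f := continuous_genFun_mul_exp k m n hx
  have hint : ∀ a b, IntervalIntegrable f MeasureTheory.volume a b := fun a b =>
    hfc.intervalIntegrable a b
  have hle : 2 * Real.pi * x ≤ Real.pi := by nlinarith
  have hx0 : 0 ≤ 2 * Real.pi * x := by positivity
  have hbound : ∀ y : ℝ, 2 * Real.pi * x ≤ |y| → |y| ≤ Real.pi →
      ‖f y‖ ≤ K / x * Real.exp ((2 - 1 / (2 * A)) * √(A * n)) := by
    intro y h1 h2
    have h3 := hK x y hx (by linarith) h1 h2
    have h4 : ‖Complex.exp (n * (x + y * Complex.I))‖ = Real.exp (n * x) := by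
      have := norm_exp_mul_add_mul_I n x y
      push_cast at this
      exact this
    simp only [hf]
    rw [norm_mul, h4]
    calc _ ≤ K / x * Real.exp (A / x - 1 / (2 * x)) * Real.exp (n * x) := by gcongr
      _ = K / x * Real.exp (A / x - 1 / (2 * A) * (A / x) + n * x) := by
        rw [mul_assoc, ← Real.exp_add]
        congr 3
        field_simp
      _ = _ := by
        rw [hxdef, natCast_mul_sqrt_div hA hn, div_sqrt_div hA hn]
        congr 2
        ring
  have hsplit : 2 * Real.pi * coeff k m n - ∫ y in -(2 * Real.pi * x)..2 * Real.pi * x, f y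
      = (∫ y in -Real.pi..-(2 * Real.pi * x), f y) + ∫ y in 2 * Real.pi * x..Real.pi, f y := by
    rw [two_pi_mul_coeff k m n hx, ← intervalIntegral.integral_add_adjacent_intervals
      (hint (-Real.pi) (-(2 * Real.pi * x))) (hint _ Real.pi),
      ← intervalIntegral.integral_add_adjacent_intervals
      (hint (-(2 * Real.pi * x)) (2 * Real.pi * x)) (hint _ Real.pi)]
    ring
  set B := K / x * Real.exp ((2 - 1 / (2 * A)) * √(A * n)) with hB
  have hB0 : 0 ≤ B := by positivity
  have h1 : ‖∫ y in -Real.pi..-(2 * Real.pi * x), f y‖ ≤ B * Real.pi := by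
    refine (intervalIntegral.norm_integral_le_of_norm_le_const (C := B) fun y hy => ?_).trans ?_
    · rw [Set.uIoc_of_le (by linarith)] at hy
      have hy0 : y ≤ 0 := by linarith [hy.2]
      refine hbound y ?_ ?_ <;> rw [abs_of_nonpos hy0]
      · linarith [hy.2]
      · linarith [hy.1]
    · gcongr
      rw [abs_of_nonneg (by linarith)]
      linarith
  have h2 : ‖∫ y in 2 * Real.pi * x..Real.pi, f y‖ ≤ B * Real.pi := by
    refine (intervalIntegral.norm_integral_le_of_norm_le_const (C := B) fun y hy => ?_).trans ?_
    · rw [Set.uIoc_of_le (by linarith)] at hy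
      have hy0 : 0 ≤ y := by linarith [hy.1]
      refine hbound y ?_ ?_ <;> rw [abs_of_nonneg hy0]
      · exact hy.1.le
      · exact hy.2
    · gcongr
      rw [abs_of_nonneg (by linarith)]
      linarith
  rw [hsplit, Real.norm_of_nonneg (by positivity)]
  refine (norm_add_le _ _).trans ((add_le_add h1 h2).trans (le_of_eq ?_))
  have h5 : x⁻¹ = A ^ (-(1 : ℝ) / 2) * (n : ℝ) ^ ((1 : ℝ) / 2) := by
    rw [← Real.rpow_neg_one, hrpow]; norm_num
  rw [hB, div_eq_mul_inv, h5]
  ring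

/-- On the arc `|y| ≤ 2πx` the bracket is replaced by its expansion to order `N`. -/
lemma arc_sub_sum_isBigO {k : ℕ} (hk : 1 ≤ k) {m : ℤ} {d : ℕ → ℂ} (hd : IsTaylorCoeff m k d)
    {N : ℕ} (hN : 1 ≤ N) :
    (fun n : ℕ => (∫ y in -(2 * Real.pi * √(growth k / n))..2 * Real.pi * √(growth k / n),
        genFun k m (Complex.exp (-((√(growth k / n) : ℝ) + y * Complex.I)))
          * Complex.exp (n * ((√(growth k / n) : ℝ) + y * Complex.I)))
      - (((2 * Real.pi) ^ (-(k : ℝ) / 2) : ℝ) : ℂ) *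
        ∑ ℓ ∈ Finset.Icc 1 N, d ℓ * arcIntegral (ℓ + k / 2) (growth k) n)
      =O[atTop] fun n : ℕ => (n : ℝ) ^ (-1 - (N : ℝ) / 2 - (k : ℝ) / 4)
        * Real.exp (2 * √(growth k * n)) := by
  have hp := Real.pi_pos
  set A := growth k with hAdef
  have hA : 0 < A := growth_pos hk
  obtain ⟨K, hK0, hK⟩ := (bracket_isBigO hd hN (2 * Real.pi)).exists_pos
  rw [IsBigOWith, eventually_nhdsWithin_iff, Metric.eventually_nhds_iff] at hK
  obtain ⟨δ, hδ, hK⟩ := hK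
  set c0 : ℝ := (2 * Real.pi) ^ (-(k : ℝ) / 2) with hc0
  have hc0' : 0 ≤ c0 := by positivity
  set s : ℝ := (k : ℝ) / 2 + N + 1 with hs
  refine IsBigO.of_bound (c0 * K * (1 + 2 * Real.pi) ^ s * (4 * Real.pi) * A ^ ((s + 1) / 2)) ?_
  filter_upwards [eventually_ge_atTop 1,
    eventually_sqrt_div_lt hA (ε := δ / (1 + 2 * Real.pi)) (by positivity)] with n hn hxn
  obtain ⟨hx, hx2⟩ := hxn
  have hrpow := sqrt_div_rpow hA n (s + 1)
  have hnx := natCast_mul_sqrt_div hA hn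
  have hAx := div_sqrt_div hA hn
  simp only [arcIntegral]
  set x := √(A / n) with hxdef
  have hle : -(2 * Real.pi * x) ≤ 2 * Real.pi * x := by nlinarith [mul_pos hp hx]
  have hcont : ∀ ℓ : ℕ, Continuous fun y : ℝ => (x + y * Complex.I : ℂ) ^ (((ℓ : ℝ) + k / 2 : ℝ) : ℂ)
      * Complex.exp (A / (x + y * Complex.I)) * Complex.exp ((n : ℝ) * (x + y * Complex.I)) :=
    fun ℓ => ((continuous_add_mul_I_cpow hx _).mul (continuous_div_add_mul_I hx A).cexp).mul
      (by fun_prop)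
  have hcsum : Continuous fun y : ℝ => (c0 : ℂ) * ∑ ℓ ∈ Finset.Icc 1 N, d ℓ *
      ((x + y * Complex.I : ℂ) ^ (((ℓ : ℝ) + k / 2 : ℝ) : ℂ)
      * Complex.exp (A / (x + y * Complex.I)) * Complex.exp ((n : ℝ) * (x + y * Complex.I))) :=
    continuous_const.mul (continuous_finsetSum _ fun ℓ _ => continuous_const.mul (hcont ℓ))
  have hint : ∀ ℓ ∈ Finset.Icc 1 N, IntervalIntegrable (fun y : ℝ => d ℓ *
      ((x + y * Complex.I : ℂ) ^ (((ℓ : ℝ) + k / 2 : ℝ) : ℂ)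
      * Complex.exp (A / (x + y * Complex.I)) * Complex.exp ((n : ℝ) * (x + y * Complex.I))))
      MeasureTheory.volume (-(2 * Real.pi * x)) (2 * Real.pi * x) :=
    fun ℓ _ => (continuous_const.mul (hcont ℓ)).intervalIntegrable _ _
  simp_rw [← intervalIntegral.integral_const_mul]
  rw [← intervalIntegral.integral_finsetSum hint,
    ← intervalIntegral.integral_const_mul, ← intervalIntegral.integral_sub
      ((continuous_genFun_mul_exp k m n hx).intervalIntegrable _ _)
      (hcsum.intervalIntegrable _ _)]
  refine (intervalIntegral.norm_integral_le_of_norm_le_const (C := c0 * K *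
    ((1 + 2 * Real.pi) * x) ^ s * Real.exp (2 * √(A * n))) fun y hy => ?_).trans ?_
  · rw [Set.uIoc_of_le hle] at hy
    have hyabs : |y| ≤ 2 * Real.pi * x := abs_le.mpr ⟨hy.1.le, hy.2⟩
    have hz := add_mul_I_ne_zero hx y
    have hzx := le_norm_add_mul_I x y
    have hzle := norm_add_mul_I_le hx hyabs
    have hzre := re_add_mul_I x y
    have hzim : ((x : ℂ) + y * Complex.I).im = y := by simp
    have hexp := norm_exp_mul_add_mul_I n x y
    set z : ℂ := x + y * Complex.I with hzdef
    have hz0 : 0 < ‖z‖ := norm_pos_iff.mpr hz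
    have hzsec : z ∈ sector (2 * Real.pi) := by
      constructor
      · rwa [hzre]
      · rwa [hzre, hzim]
    have hR := hK (y := z) (by
      rw [dist_zero_right]
      refine hzle.trans_lt ?_
      rw [lt_div_iff₀ (by positivity)] at hx2
      linarith) hzsec
    have heq : genFun k m (Complex.exp (-z)) * Complex.exp (n * z)
        - (c0 : ℂ) * ∑ ℓ ∈ Finset.Icc 1 N, d ℓ *
          (z ^ (((ℓ : ℝ) + k / 2 : ℝ) : ℂ) * Complex.exp (A / z) * Complex.exp ((n : ℝ) * z))
        = (c0 : ℂ) * (z ^ (((k : ℝ) / 2 : ℝ) : ℂ) * Complex.exp (A / z) *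
          (bracket k m z - ∑ ℓ ∈ Finset.Icc 1 N, d ℓ * z ^ ℓ)) * Complex.exp ((n : ℝ) * z) := by
      have hterm : ∀ ℓ ∈ Finset.Icc 1 N, d ℓ *
          (z ^ (((ℓ : ℝ) + k / 2 : ℝ) : ℂ) * Complex.exp (A / z) * Complex.exp ((n : ℝ) * z))
          = (z ^ (((k : ℝ) / 2 : ℝ) : ℂ) * Complex.exp (A / z) * Complex.exp ((n : ℝ) * z))
            * (d ℓ * z ^ ℓ) := fun ℓ _ => by
        rw [Complex.ofReal_add, Complex.cpow_add _ _ hz, Complex.ofReal_natCast,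
          Complex.cpow_natCast]
        ring
      rw [Finset.sum_congr rfl hterm, ← Finset.mul_sum, genFun_exp_neg k m (by rwa [hzre])]
      push_cast
      ring
    rw [heq, norm_mul, norm_mul, norm_mul, norm_mul, hexp, Complex.norm_real,
      Real.norm_of_nonneg hc0', Complex.norm_cpow_real, norm_exp_inv]
    have hAz : A * (z.re / ‖z‖ ^ 2) ≤ A / x := by
      rw [hzre, div_eq_mul_inv A]
      gcongr
      rw [div_le_iff₀ (by positivity), inv_mul_eq_div, le_div_iff₀ hx]
      nlinarith
    have hpow : ‖z‖ ^ ((k : ℝ) / 2) * ‖z ^ (N + 1)‖ = ‖z‖ ^ s := by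
      rw [norm_pow, ← Real.rpow_natCast, ← Real.rpow_add hz0, hs]
      congr 1
      push_cast
      ring
    calc _ ≤ c0 * (‖z‖ ^ ((k : ℝ) / 2) * Real.exp (A / x) * (K * ‖z ^ (N + 1)‖))
          * Real.exp (n * x) := by gcongr
      _ = c0 * K * (‖z‖ ^ ((k : ℝ) / 2) * ‖z ^ (N + 1)‖) * (Real.exp (A / x) * Real.exp (n * x)) := by
          ring
      _ = c0 * K * ‖z‖ ^ s * Real.exp (2 * √(A * n)) := by
          rw [hpow, ← Real.exp_add, hnx, hAx, two_mul]
      _ ≤ _ := by gcongr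
  · rw [abs_of_nonneg (by linarith), Real.norm_of_nonneg (by positivity),
      Real.mul_rpow (by positivity) hx.le]
    have h1 : x ^ s * x = A ^ ((s + 1) / 2) * (n : ℝ) ^ (-1 - (N : ℝ) / 2 - (k : ℝ) / 4) := by
      rw [← Real.rpow_add_one hx.ne', hrpow]
      congr 2
      rw [hs]
      ring
    refine le_of_eq ?_
    calc _ = c0 * K * (1 + 2 * Real.pi) ^ s * (4 * Real.pi) * (x ^ s * x)
          * Real.exp (2 * √(A * n)) := by ring
      _ = _ := by rw [h1]; ring

/-- The cut to the arc, the expansion on the arc, and the comparison with the Bessel series all have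
errors within the bound; the factor `2π` of the coefficient integral cancels in the end. -/
lemma coeff_asymptotic {k : ℕ} (hk : 1 ≤ k) {m : ℤ} {d : ℕ → ℂ} (hd : IsTaylorCoeff m k d)
    {N : ℕ} (hN : 1 ≤ N) :
    (fun n : ℕ => coeff k m n - (((2 * Real.pi) ^ (-(k : ℝ) / 2) : ℝ) : ℂ) *
        ∑ ℓ ∈ Finset.Icc 1 N, d ℓ * ((mainFactor k ℓ n : ℝ) : ℂ))
      =O[atTop] fun n : ℕ => (n : ℝ) ^ (-1 - (N : ℝ) / 2 - (k : ℝ) / 4)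
        * Real.exp (Real.pi * √(2 * (k : ℝ) * n / 3)) := by
  set c0 : ℂ := (((2 * Real.pi) ^ (-(k : ℝ) / 2) : ℝ) : ℂ) with hc0
  have hexp : ∀ n : ℕ, Real.pi * √(2 * (k : ℝ) * n / 3) = 2 * √(growth k * n) := fun n => by
    rw [growth, show (k : ℝ) * Real.pi ^ 2 / 6 * n = (Real.pi / 2) ^ 2 * (2 * k * n / 3) by ring,
      Real.sqrt_mul (by positivity), Real.sqrt_sq (by positivity)]
    ring
  simp_rw [hexp]
  have h1 := coeff_sub_arc_isBigO hk m (-1 - (N : ℝ) / 2 - (k : ℝ) / 4)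
  have h2 := arc_sub_sum_isBigO hk hd hN
  have h3 : (fun n : ℕ => c0 * ∑ ℓ ∈ Finset.Icc 1 N, d ℓ *
      (((2 * Real.pi * ∑' j, besselTerm (ℓ + k / 2) (growth k) n j : ℝ) : ℂ)
        - arcIntegral (ℓ + k / 2) (growth k) n)) =O[atTop] fun n : ℕ =>
        (n : ℝ) ^ (-1 - (N : ℝ) / 2 - (k : ℝ) / 4) * Real.exp (2 * √(growth k * n)) :=
    (IsBigO.fun_sum fun ℓ _ => (tsum_besselTerm_sub_arcIntegral_isBigO (by positivity)
      (growth_pos hk) _).const_mul_left (d ℓ)).const_mul_left c0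
  refine (((h1.add h2).sub h3).const_mul_left (2 * (Real.pi : ℂ))⁻¹).congr' ?_ EventuallyEq.rfl
  filter_upwards [eventually_ge_atTop 1] with n hn
  have hpi : (Real.pi : ℂ) ≠ 0 := Complex.ofReal_ne_zero.mpr Real.pi_ne_zero
  have hmf : ∀ ℓ ∈ Finset.Icc 1 N, d ℓ *
      (((2 * Real.pi * ∑' j, besselTerm (ℓ + k / 2) (growth k) n j : ℝ) : ℂ)
        - arcIntegral (ℓ + k / 2) (growth k) n)
      = 2 * Real.pi * (d ℓ * ((mainFactor k ℓ n : ℝ) : ℂ))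
        - d ℓ * arcIntegral (ℓ + k / 2) (growth k) n := fun ℓ _ => by
    rw [mainFactor_eq_tsum hk ℓ hn]
    push_cast
    ring
  rw [Finset.sum_congr rfl hmf, Finset.sum_sub_distrib, ← Finset.mul_sum]
  have hcancel : ∀ a J S B : ℂ, (2 * (Real.pi : ℂ))⁻¹ *
      ((2 * Real.pi * a - J) + (J - c0 * S) - c0 * (2 * Real.pi * B - S)) = a - c0 * B :=
    fun a J S B => by
      field_simp
      ring
  exact hcancel _ _ _ _

end

end InverseTheta

/-- For `k ≥ 1`: the coefficients `a_{m,k}(n)` and `d_{m,k}(ℓ)` are well defined, and for all `m`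
and all `N ≥ 1` the asymptotic expansion of `a_{m,k}(n)` as `n → ∞` holds. -/
theorem theorem1 (k : ℕ) (hk : 1 ≤ k) :
    (∃! a : ℤ → ℕ → ℂ, InverseTheta.IsCoeff k a) ∧
    (∀ m : ℤ, ∃! d : ℕ → ℂ, InverseTheta.IsTaylorCoeff m k d) ∧
    ∀ a : ℤ → ℕ → ℂ, InverseTheta.IsCoeff k a →
      ∀ (m : ℤ) (d : ℕ → ℂ), InverseTheta.IsTaylorCoeff m k d →
        ∀ N : ℕ, 1 ≤ N →
          (fun n : ℕ => a m n -
              (((2 * Real.pi) ^ (-(k : ℝ) / 2) : ℝ) : ℂ) *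
                ∑ ℓ ∈ Finset.Icc 1 N, d ℓ * ((InverseTheta.mainFactor k ℓ n : ℝ) : ℂ))
            =O[atTop] fun n : ℕ =>
              (n : ℝ) ^ (-1 - (N : ℝ) / 2 - (k : ℝ) / 4)
                * Real.exp (Real.pi * √(2 * (k : ℝ) * n / 3)) := by
  have hcoeff := InverseTheta.isCoeff_coeff k
  refine ⟨⟨InverseTheta.coeff k, hcoeff, fun a ha => ha.unique hcoeff⟩, fun m => ?_,
    fun a ha m d hd N hN => ?_⟩
  · obtain ⟨d, hd⟩ := InverseTheta.exists_isTaylorCoeff m k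
    exact ⟨d, hd, fun d' hd' => hd'.unique hd⟩
  · rw [ha.unique hcoeff]
    exact InverseTheta.coeff_asymptotic hk hd hN
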